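/- Let $L>0$, and let $\rho,a\in BV(0,L)$ satisfy $0<\rho_0\le\rho(x)\le\rho_1$ and $0<a_0\le a(x)\le a_1$ for a.e. $x\in(0,L)$, with constants $\rho_0,\rho_1,a_0,a_1$. Put $\beta=\operatorname{ess\,sup}_{x\in[0,L]}\sqrt{\rho(x)/a(x)}$ and let $T>L\beta$. Then there is a constant $C_1>0$ (which may depend on $L$, $T$, $\rho$, $a$, but not on $s_0$ or $\psi$) such that $$\|s_0\|_{H^1(L\beta,T)}\le C_1\,\|\psi_x(0,\cdot)\|_{L^2(0,T)}$$ for every $s_0\in H^1(L\beta,T)$ with $s_0(L\beta)=0$ and every finite-energy solution $\psi=\psi(x,t)$ of the adjoint system $$\begin{cases}\rho(x)\psi_{tt}-(a(x)\psi_x)_x=0, & 0<x<L,\ 0<t<T,\\ \psi(x,T)=0,\quad \psi_t(x,T)=0, & 0<x<L,\\ \psi(0,t)=0,\quad \psi(L,t)=s(t), & 0<t<T,\end{cases}$$ where $s=s_0$ on $[L\beta,T]$ and $s=0$ on $[0,L\beta)$. Here a finite-energy solution is a function $\psi$ with $(\psi,\psi_t)\in C([0,T];H^1(0,L)\times L^2(0,L))$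 that satisfies the equation in the sense of distributions on $(0,L)\times(0,T)$ and the final and boundary conditions, and such that $\psi_x(0,\cdot)\in L^2(0,T)$, where $\psi_x(0,\cdot)$ is the limit of $\psi(h,\cdot)/h$ in the distributions on $(0,T)$ as $h\to0^+$. -/

import Mathlib

open MeasureTheory Set Filter Topology
open scoped ContDiff

noncomputable section

namespace SidewiseWave

/-- The norm of `L²(c,d)`. -/
def l2Norm (c d : ℝ) (u : ℝ → ℝ) : ℝ :=
  √(∫ x in c..d, u x ^ 2)

/-- Membership in `L²(c,d)`. -/
def MemL2 (c d : ℝ) (u : ℝ → ℝ) : Prop :=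
  MemLp u 2 (volume.restrict (Ioo c d))

/-- `u ∈ H¹(c,d)`, where `u` is the continuous representative: `u` is absolutely continuous on
`[c,d]` and its (almost everywhere defined) derivative is in `L²(c,d)`. -/
def MemH1 (c d : ℝ) (u : ℝ → ℝ) : Prop :=
  AbsolutelyContinuousOnInterval u c d ∧ MemL2 c d (deriv u)

/-- The norm of `H¹(c,d)`. -/
def h1Norm (c d : ℝ) (u : ℝ → ℝ) : ℝ :=
  √((∫ x in c..d, u x ^ 2) + ∫ x in c..d, deriv u x ^ 2)

/-- `f ∈ BV(c,d)`: the almost everywhere class of `f` on `(c,d)` has a representative of finite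
total variation. -/
def MemBV (c d : ℝ) (f : ℝ → ℝ) : Prop :=
  ∃ g : ℝ → ℝ, BoundedVariationOn g (Ioo c d) ∧ f =ᵐ[volume.restrict (Ioo c d)] g

/-- `β = ess sup √(ρ/a)` over `[0,L]`. -/
def slowness (L : ℝ) (ρ a : ℝ → ℝ) : ℝ :=
  essSup (fun x => √(ρ x / a x)) (volume.restrict (Icc 0 L))

/-- `φ = φ(x,t)` is a test function in `C_c^∞((0,L) × (0,T))`. -/
def IsTestFunction (L T : ℝ) (φ : ℝ → ℝ → ℝ) : Prop :=
  ContDiff ℝ ∞ (Function.uncurry φ) ∧ HasCompactSupport (Function.uncurry φ) ∧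
    tsupport (Function.uncurry φ) ⊆ Ioo 0 L ×ˢ Ioo 0 T

/-- `g` is the lateral derivative `ψ_x(0,·)` on `(0,T)`: the right derivative at `x = 0` of
`x ↦ ψ(x,·)`, the limit of the difference quotients being taken in the distributions on
`(0,T)`. -/
def IsLateralDerivAtZero (T : ℝ) (ψ : ℝ → ℝ → ℝ) (g : ℝ → ℝ) : Prop :=
  ∀ η : ℝ → ℝ, ContDiff ℝ ∞ η → HasCompactSupport η → tsupport η ⊆ Ioo 0 T →
    Tendsto (fun h : ℝ => ∫ t in (0 : ℝ)..T, (ψ h t - ψ 0 t) / h * η t) (𝓝[>] 0)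
      (𝓝 (∫ t in (0 : ℝ)..T, g t * η t))

/-- `ψ = ψ(x,t)`, with time derivative `ψt` and lateral derivative `g = ψ_x(0,·)`, is a
finite-energy solution of
`ρ ψ_tt - (a ψ_x)_x = 0` in `(0,L) × (0,T)`, `ψ(·,T) = ψ_t(·,T) = 0`, `ψ(0,·) = 0`, `ψ(L,·) = s`.
For each `t` the function `ψ(·,t)` is the continuous representative of its class. -/
structure IsFiniteEnergySolution (L T : ℝ) (ρ a s : ℝ → ℝ)
    (ψ ψt : ℝ → ℝ → ℝ) (g : ℝ → ℝ) : Prop where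
  /-- `ψ ∈ C([0,T]; H¹(0,L))` -/
  memH1 : ∀ t ∈ Icc 0 T, MemH1 0 L (fun x => ψ x t)
  contH1 : ∀ t ∈ Icc 0 T,
    Tendsto (fun τ => h1Norm 0 L (fun x => ψ x τ - ψ x t)) (𝓝[Icc 0 T] t) (𝓝 0)
  /-- `ψt ∈ C([0,T]; L²(0,L))` -/
  memL2 : ∀ t ∈ Icc 0 T, MemL2 0 L (fun x => ψt x t)
  contL2 : ∀ t ∈ Icc 0 T,
    Tendsto (fun τ => l2Norm 0 L (fun x => ψt x τ - ψt x t)) (𝓝[Icc 0 T] t) (𝓝 0)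
  /-- `ψt` is the time derivative of `ψ`, as an `L²(0,L)`-valued function on `[0,T]` -/
  hasTimeDeriv : ∀ t ∈ Icc 0 T,
    Tendsto (fun τ => l2Norm 0 L (fun x => (ψ x τ - ψ x t) / (τ - t) - ψt x t))
      (𝓝[Icc 0 T \ {t}] t) (𝓝 0)
  /-- the equation, in the sense of distributions -/
  equation : ∀ φ : ℝ → ℝ → ℝ, IsTestFunction L T φ →
    ∫ t in (0 : ℝ)..T, ∫ x in (0 : ℝ)..L,
      (-(ρ x * ψt x t * deriv (fun τ => φ x τ) t)
        + a x * deriv (fun y => ψ y t) x * deriv (fun y => φ y t) x) = 0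
  /-- zero final data -/
  final : ∀ x ∈ Ioo 0 L, ψ x T = 0
  final_deriv : ∀ᵐ x ∂(volume.restrict (Ioo 0 L)), ψt x T = 0
  /-- lateral boundary conditions -/
  left : ∀ t ∈ Ioo 0 T, ψ 0 t = 0
  right : ∀ t ∈ Ioo 0 T, ψ L t = s t
  /-- `ψ_x(0,·) = g ∈ L²(0,T)` -/
  lateral : IsLateralDerivAtZero T ψ g
  lateral_memL2 : MemL2 0 T g

end SidewiseWave

end

noncomputable section

namespace SidewiseWave

/-! The idea is to exchange the roles of `x` and `t`. With `V = ψ_t` and `P = a ψ_x` the wave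
equation reads `V_x = P_t / a`, `P_x = ρ V_t`: an evolution in `x` with Cauchy data `V = 0`, `P = a
ψ_x(0,·)` at `x = 0`. At `x = L` and `t > Lβ` one has `V = s₀'`, so the claim is an energy estimate
propagated sidewise from `0` to `L`.

The energy at `x` is `∫ w(t - βx) (r V² + q P²) dt` with `r = θρ`, `q = θ/a`
(`IsSidewiseSystem.energy_le`). The factor `θ` is the exponential of minus the variation of the
coefficients, so `r` and `q` are antitone (`exists_weights`) and their derivatives, which are only
measures, have the favourable sign (`IsPrimitive.antitone_mul_sub_le`); no Gronwall argument is
needed. Because `θ` is common to both weights, the cross terms combine into `2 (θρ/a) (VP)_t`. After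
integration by parts in `t`, the terms with `w'` form a nonpositive quadratic form, since `ρ/a ≤
β²`. What remains is a term at a late time `t₁`, which disappears as `t₁ → T` because the final data
vanish.

To have enough regularity, `ψ` is averaged in `t`. The coefficients do not depend on `t`, so the
equation persists, and the averaged flux is absolutely continuous in `x` by the du Bois-Reymond
lemma (`IsWeakWave.ae_eq_flux`). Fatou's lemma removes the averaging in
`IsFiniteEnergySolution.integral_deriv_sq_le`. The condition `s₀(Lβ) = 0` enters only at the end, to
bound the `H¹` norm by the norm of `s₀'`. -/

/-! ### Primitives and a Stieltjes inequality. -/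

/-- `f` is a primitive on `[0,L]` of the integrable function `f'`. -/
structure IsPrimitive (L : ℝ) (f f' : ℝ → ℝ) : Prop where
  integrable : IntervalIntegrable f' volume 0 L
  eq : ∀ x ∈ Icc 0 L, f x = f 0 + ∫ y in (0 : ℝ)..x, f' y

lemma IsPrimitive.intervalIntegrable {L : ℝ} {f f' : ℝ → ℝ} (h : IsPrimitive L f f') {x y : ℝ}
    (hx : x ∈ Icc 0 L) (hy : y ∈ Icc 0 L) : IntervalIntegrable f' volume x y :=
  h.integrable.mono_set <| by
    rw [uIcc_of_le (hx.1.trans hx.2)]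
    exact uIcc_subset_Icc hx hy

lemma IsPrimitive.sub_eq {L : ℝ} {f f' : ℝ → ℝ} (h : IsPrimitive L f f') {x y : ℝ}
    (hx : x ∈ Icc 0 L) (hy : y ∈ Icc 0 L) : f y - f x = ∫ z in x..y, f' z := by
  have h0 : (0 : ℝ) ∈ Icc 0 L := ⟨le_rfl, hx.1.trans hx.2⟩
  rw [h.eq x hx, h.eq y hy, ← intervalIntegral.integral_add_adjacent_intervals
    (h.intervalIntegrable h0 hx) (h.intervalIntegrable hx hy)]
  ring

lemma IsPrimitive.congr {L : ℝ} {f f' g' : ℝ → ℝ} (h : IsPrimitive L f f')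
    (hg : ∀ᵐ x, x ∈ Ioc 0 L → f' x = g' x) (hL : 0 ≤ L) : IsPrimitive L f g' := by
  have hae : f' =ᵐ[volume.restrict (uIoc 0 L)] g' := by
    rw [uIoc_of_le hL]
    exact (ae_restrict_iff' measurableSet_Ioc).2 hg
  refine ⟨h.integrable.congr_ae hae, fun x hx => ?_⟩
  rw [h.eq x hx]
  congr 1
  refine intervalIntegral.integral_congr_ae ?_
  filter_upwards [hg] with y hy hyx
  rw [uIoc_of_le hx.1] at hyx
  exact hy ⟨hyx.1, hyx.2.trans hx.2⟩

/-- A primitive agrees on `[0,L]` with an absolutely continuous function whose derivative is a.e.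
the given density, so this reduces to the product rule for absolutely continuous functions. -/
lemma IsPrimitive.mul {L : ℝ} (hL : 0 ≤ L) {f f' g g' : ℝ → ℝ}
    (hf : IsPrimitive L f f') (hg : IsPrimitive L g g') :
    IsPrimitive L (fun x => f x * g x) (fun x => f' x * g x + f x * g' x) := by
  have key : ∀ {f f' : ℝ → ℝ}, IsPrimitive L f f' →
      ∃ F : ℝ → ℝ, AbsolutelyContinuousOnInterval F 0 L ∧ (∀ x ∈ Icc 0 L, f x = F x) ∧
        ∀ᵐ x, x ∈ Icc 0 L → deriv F x = f' x := by
    intro f f' h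
    refine ⟨fun x => f 0 + ∫ y in (0 : ℝ)..x, f' y, ?_, h.eq, ?_⟩
    · exact AbsolutelyContinuousOnInterval.add
        (LipschitzOnWith.absolutelyContinuousOnInterval (K := 0) (LipschitzWith.const _).lipschitzOnWith)
        (h.integrable.absolutelyContinuousOnInterval_intervalIntegral left_mem_uIcc)
    · filter_upwards [h.integrable.ae_hasDerivAt_integral] with x hx hx'
      rw [uIcc_of_le hL] at hx
      exact ((hx hx' 0 ⟨le_rfl, hL⟩).const_add (f 0)).deriv
  obtain ⟨F, hF, hfF, hF'⟩ := key hf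
  obtain ⟨G, hG, hgG, hG'⟩ := key hg
  have hFc := hF.continuousOn
  have hGc := hG.continuousOn
  have e1 : ∀ᵐ x, x ∈ Icc 0 L →
      deriv F x * G x + F x * deriv G x = f' x * g x + f x * g' x := by
    filter_upwards [hF', hG'] with x h1 h2 hx
    rw [h1 hx, h2 hx, hfF x hx, hgG x hx]
  have hint : IntervalIntegrable (fun x => f' x * g x + f x * g' x) volume 0 L := by
    have : IntervalIntegrable (fun x => f' x * G x + F x * g' x) volume 0 L :=
      (hf.integrable.mul_continuousOn hGc).add (hg.integrable.continuousOn_mul hFc)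
    refine this.congr fun x hx => ?_
    rw [uIoc_of_le hL] at hx
    simp only [hfF x (Ioc_subset_Icc_self hx), hgG x (Ioc_subset_Icc_self hx)]
  refine ⟨hint, fun x hx => ?_⟩
  have h0 : (0 : ℝ) ∈ Icc 0 L := ⟨le_rfl, hL⟩
  have hsub : uIcc 0 x ⊆ uIcc 0 L := by
    rw [uIcc_of_le hL, uIcc_of_le hx.1]; exact Icc_subset_Icc_right hx.2
  have := (hF.mono hsub).integral_deriv_mul_eq_sub (hG.mono hsub)
  rw [hfF x hx, hgG x hx, hfF 0 h0, hgG 0 h0]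
  have e2 : ∫ y in (0 : ℝ)..x, f' y * g y + f y * g' y
      = ∫ y in (0 : ℝ)..x, deriv F y * G y + F y * deriv G y := by
    refine intervalIntegral.integral_congr_ae ?_
    filter_upwards [e1] with y hy hyx
    rw [uIoc_of_le hx.1] at hyx
    exact (hy ⟨hyx.1.le, hyx.2.trans hx.2⟩).symm
  rw [e2, this]; ring

lemma isPrimitive_of_hasDerivAt {L : ℝ} {f f' : ℝ → ℝ}
    (h : ∀ x, HasDerivAt f (f' x) x) (hc : Continuous f') : IsPrimitive L f f' := by
  refine ⟨hc.intervalIntegrable _ _, fun x _ => ?_⟩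
  rw [intervalIntegral.integral_eq_sub_of_hasDerivAt (fun y _ => h y) (hc.intervalIntegrable _ _)]
  ring

/-- A Stieltjes integration by parts inequality: `d(rf) ≤ r df` for antitone `r` and `f ≥ 0`. -/
lemma IsPrimitive.antitone_mul_sub_le {L M : ℝ} (hL : 0 ≤ L) {r f f' : ℝ → ℝ} (hr : Antitone r)
    (hf : IsPrimitive L f f') (hf0 : ∀ x ∈ Icc 0 L, 0 ≤ f x)
    (hM : ∀ᵐ x, x ∈ Icc 0 L → |f' x| ≤ M) :
    r L * f L - r 0 * f 0 ≤ ∫ x in (0 : ℝ)..L, r x * f' x := by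
  have hri : ∀ x ∈ Icc 0 L, ∀ y ∈ Icc 0 L, IntervalIntegrable (fun z => r z * f' z) volume x y := by
    intro x hx y hy
    have h1 := hf.intervalIntegrable hx hy
    rw [intervalIntegrable_iff] at h1 ⊢
    refine Integrable.bdd_mul (c := max |r 0| |r L|) h1 hr.measurable.aestronglyMeasurable ?_
    refine (ae_restrict_iff' measurableSet_uIoc).2 (ae_of_all _ fun z hz => ?_)
    have hz' : z ∈ Icc 0 L := uIcc_subset_Icc hx hy (uIoc_subset_uIcc hz)
    rw [Real.norm_eq_abs]
    exact abs_le_max_abs_abs (hr hz'.2) (hr hz'.1) |>.trans_eq (max_comm _ _)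
  -- On a cell of the uniform partition, `r` is frozen at the left endpoint: the increment of `r f`
  -- is at most `r(zᵢ)` times that of `f`, because `f ≥ 0`. Freezing costs `M (r(zᵢ) - r(zᵢ₊₁))
  -- L/n`, and these errors telescope to `O(1/n)` without any continuity of `r`.
  have key : ∀ n : ℕ, 0 < n → r L * f L - r 0 * f 0 ≤
      (∫ x in (0 : ℝ)..L, r x * f' x) + M * (r 0 - r L) * (L / n) := by
    intro n hn
    have hn' : (0 : ℝ) < n := by exact_mod_cast hn
    set z : ℕ → ℝ := fun i => L * i / n with hz
    have z0 : z 0 = 0 := by simp [hz]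
    have zn : z n = L := by simp only [hz]; field_simp
    have zmono : ∀ i, z i ≤ z (i + 1) := by
      intro i; simp only [hz]; push_cast; gcongr; linarith
    have zdiff : ∀ i, z (i + 1) - z i = L / n := by
      intro i; simp only [hz]; push_cast; field_simp; ring
    have zmem : ∀ i, i ≤ n → z i ∈ Icc 0 L := by
      intro i hi
      have : (i : ℝ) ≤ n := by exact_mod_cast hi
      refine ⟨by positivity, ?_⟩
      simp only [hz]
      rw [div_le_iff₀ hn']
      gcongr
    have step : ∀ i ∈ Finset.range n, r (z (i + 1)) * f (z (i + 1)) - r (z i) * f (z i) ≤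
        (∫ x in z i..z (i + 1), r x * f' x) + M * (r (z i) - r (z (i + 1))) * (L / n) := by
      intro i hi
      have hi' := Finset.mem_range.1 hi
      have m1 := zmem i hi'.le
      have m2 := zmem (i + 1) hi'
      have e1 : r (z (i + 1)) * f (z (i + 1)) ≤ r (z i) * f (z (i + 1)) :=
        mul_le_mul_of_nonneg_right (hr (zmono i)) (hf0 _ m2)
      have e2 : r (z i) * (f (z (i + 1)) - f (z i)) = ∫ x in z i..z (i + 1), r (z i) * f' x := by
        rw [hf.sub_eq m1 m2, intervalIntegral.integral_const_mul]
      have e3 : (∫ x in z i..z (i + 1), r (z i) * f' x) - (∫ x in z i..z (i + 1), r x * f' x)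
          ≤ M * (r (z i) - r (z (i + 1))) * (L / n) := by
        rw [← intervalIntegral.integral_sub ((hf.intervalIntegrable m1 m2).const_mul _)
          (hri _ m1 _ m2), ← zdiff i]
        refine (le_abs_self _).trans ?_
        rw [← Real.norm_eq_abs]
        have := intervalIntegral.norm_integral_le_of_norm_le_const_ae (a := z i) (b := z (i + 1))
          (f := fun x => r (z i) * f' x - r x * f' x) (C := M * (r (z i) - r (z (i + 1)))) ?_
        · rwa [abs_of_nonneg (by linarith [zmono i])] at this
        · filter_upwards [hM] with x hx hxi
          rw [uIoc_of_le (zmono i)] at hxi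
          have hx' := hx ⟨m1.1.trans hxi.1.le, hxi.2.trans m2.2⟩
          have a1 := hr hxi.1.le
          have a2 := hr hxi.2
          rw [← sub_mul, Real.norm_eq_abs, abs_mul, abs_of_nonneg (by linarith), mul_comm]
          have hM0 : 0 ≤ M := (abs_nonneg _).trans hx'
          gcongr
      linarith
    have s1 := Finset.sum_le_sum step
    rw [Finset.sum_range_sub (fun i => r (z i) * f (z i)), z0, zn, Finset.sum_add_distrib,
      intervalIntegral.sum_integral_adjacent_intervals
        (fun i hi => hri _ (zmem i hi.le) _ (zmem (i + 1) hi)), z0, zn, ← Finset.sum_mul,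
      ← Finset.mul_sum, Finset.sum_range_sub' (fun i => r (z i)), z0, zn] at s1
    exact s1
  have lim : Tendsto (fun n : ℕ => (∫ x in (0 : ℝ)..L, r x * f' x) + M * (r 0 - r L) * (L / n))
      atTop (𝓝 ((∫ x in (0 : ℝ)..L, r x * f' x) + M * (r 0 - r L) * 0)) :=
    ((tendsto_const_div_atTop_nhds_zero_nat L).const_mul _).const_add _
  rw [mul_zero, add_zero] at lim
  exact ge_of_tendsto lim ((eventually_gt_atTop 0).mono key)

/-- Integration in a parameter of a family of primitives. -/
lemma IsPrimitive.integral_param {L t₀ t₁ K : ℝ} (hL : 0 ≤ L) (ht : t₀ ≤ t₁) {G H₀ H₁ : ℝ → ℝ → ℝ}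
    {c : ℝ → ℝ} (hH₀ : Continuous (Function.uncurry H₀)) (hH₁ : Continuous (Function.uncurry H₁))
    (hG : Continuous (Function.uncurry G))
    (hc : Measurable c) (hcK : ∀ x, |c x| ≤ K)
    (h : ∀ t ∈ Icc t₀ t₁, IsPrimitive L (fun x => G x t) (fun x => H₀ x t + c x * H₁ x t)) :
    IsPrimitive L (fun x => ∫ t in t₀..t₁, G x t)
      (fun x => (∫ t in t₀..t₁, H₀ x t) + c x * ∫ t in t₀..t₁, H₁ x t) ∧
    ∃ M, ∀ x ∈ Icc 0 L, |(∫ t in t₀..t₁, H₀ x t) + c x * ∫ t in t₀..t₁, H₁ x t| ≤ M := by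
  have c0 := intervalIntegral.continuous_parametric_intervalIntegral_of_continuous' (μ := volume)
    hH₀ t₀ t₁
  have c1 := intervalIntegral.continuous_parametric_intervalIntegral_of_continuous' (μ := volume)
    hH₁ t₀ t₁
  obtain ⟨M0, hM0⟩ := isCompact_Icc.exists_bound_of_continuousOn (s := Icc 0 L) c0.continuousOn
  obtain ⟨M1, hM1⟩ := isCompact_Icc.exists_bound_of_continuousOn (s := Icc 0 L) c1.continuousOn
  have hK : 0 ≤ K := (abs_nonneg _).trans (hcK 0)
  have bd : ∀ x ∈ Icc 0 L,
      |(∫ t in t₀..t₁, H₀ x t) + c x * ∫ t in t₀..t₁, H₁ x t| ≤ M0 + K * M1 := by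
    intro x hx
    refine (abs_add_le _ _).trans (add_le_add (hM0 x hx) ?_)
    rw [abs_mul]
    exact mul_le_mul (hcK x) (hM1 x hx) (abs_nonneg _) hK
  refine ⟨⟨?_, fun x hx => ?_⟩, _, bd⟩
  · rw [intervalIntegrable_iff, uIoc_of_le hL]
    refine Measure.integrableOn_of_bounded (M := M0 + K * M1) (by simp) ?_ ?_
    · exact (c0.measurable.add (hc.mul c1.measurable)).aestronglyMeasurable
    · exact (ae_restrict_iff' measurableSet_Ioc).2 (ae_of_all _ fun x hx =>
        bd x (Ioc_subset_Icc_self hx))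
  · have e1 : ∫ t in t₀..t₁, G x t
        = ∫ t in t₀..t₁, (G 0 t + ∫ y in (0 : ℝ)..x, (H₀ y t + c y * H₁ y t)) := by
      refine intervalIntegral.integral_congr fun t ht' => ?_
      rw [uIcc_of_le ht] at ht'
      exact (h t ht').eq x hx
    have i0 : ∀ x, IntervalIntegrable (fun t => G x t) volume t₀ t₁ := fun x =>
      (hG.comp (Continuous.prodMk_right x)).intervalIntegrable _ _
    have e2 : ∀ t ∈ Icc t₀ t₁, ∫ y in (0 : ℝ)..x, (H₀ y t + c y * H₁ y t) = G x t - G 0 t := by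
      intro t ht'; rw [(h t ht').eq x hx]; ring
    -- Fubini on the rectangle, where the integrand is bounded. The only discontinuous factor `c`
    -- depends on `y` alone and comes out of the `t`-integral.
    rw [e1, intervalIntegral.integral_add (i0 0), ← intervalIntegral_intervalIntegral_swap]
    · congr 1
      refine intervalIntegral.integral_congr fun y _ => ?_
      rw [intervalIntegral.integral_add, intervalIntegral.integral_const_mul]
      · exact (hH₀.comp (Continuous.prodMk_right y)).intervalIntegrable _ _
      · exact ((hH₁.comp (Continuous.prodMk_right y)).intervalIntegrable _ _).const_mul _
    · obtain ⟨N0, hN0⟩ := (isCompact_Icc.prod isCompact_Icc).exists_bound_of_continuousOn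
        (s := Icc 0 x ×ˢ Icc t₀ t₁) hH₀.continuousOn
      obtain ⟨N1, hN1⟩ := (isCompact_Icc.prod isCompact_Icc).exists_bound_of_continuousOn
        (s := Icc 0 x ×ˢ Icc t₀ t₁) hH₁.continuousOn
      rw [uIoc_of_le hx.1, uIoc_of_le ht]
      refine Measure.integrableOn_of_bounded (M := N0 + K * N1) ?_ ?_ ?_
      · rw [Measure.volume_eq_prod, Measure.prod_prod]
        simp [ENNReal.mul_eq_top]
      · exact (hH₀.measurable.add ((hc.comp measurable_fst).mul
          hH₁.measurable)).aestronglyMeasurable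
      · refine (ae_restrict_iff' (measurableSet_Ioc.prod measurableSet_Ioc)).2
          (ae_of_all _ fun p hp => ?_)
        have hp' : p ∈ Icc 0 x ×ˢ Icc t₀ t₁ :=
          ⟨Ioc_subset_Icc_self hp.1, Ioc_subset_Icc_self hp.2⟩
        refine (norm_add_le _ _).trans (add_le_add (hN0 p hp') ?_)
        rw [norm_mul]
        exact mul_le_mul (hcK _) (hN1 p hp') (norm_nonneg _) hK
    · refine ((i0 x).sub (i0 0)).congr fun t ht' => ?_
      rw [uIoc_of_le ht] at ht'
      exact (e2 t (Ioc_subset_Icc_self ht')).symm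

/-! ### The sidewise system and its weighted energy. -/

/-- A regular solution `(V, P)` on `[0,L] × [t₀,t₁]` of the sidewise system
`V_x = α P_t`, `P_x = ρ V_t`. -/
structure IsSidewiseSystem (L t₀ t₁ : ℝ) (ρ α : ℝ → ℝ) (V P Vt Pt : ℝ → ℝ → ℝ) : Prop where
  contV : Continuous (Function.uncurry V)
  contP : Continuous (Function.uncurry P)
  contVt : Continuous (Function.uncurry Vt)
  contPt : Continuous (Function.uncurry Pt)
  derivV : ∀ x ∈ Icc 0 L, ∀ t ∈ Icc t₀ t₁, HasDerivAt (V x) (Vt x t) t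
  derivP : ∀ x ∈ Icc 0 L, ∀ t ∈ Icc t₀ t₁, HasDerivAt (P x) (Pt x t) t
  primV : ∀ t ∈ Icc t₀ t₁, IsPrimitive L (fun x => V x t) (fun x => α x * Pt x t)
  primP : ∀ t ∈ Icc t₀ t₁, IsPrimitive L (fun x => P x t) (fun x => ρ x * Vt x t)

/-- Growth of the weighted energy `r ∫ w(t - βx) V² dt` of one component, for antitone `r`. -/
lemma weighted_energy_le {L t₀ t₁ β K : ℝ} (hL : 0 ≤ L) (ht : t₀ ≤ t₁)
    {r c w w' : ℝ → ℝ} {V Z : ℝ → ℝ → ℝ} (hr : Antitone r) (hc : Measurable c)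
    (hcK : ∀ x, |c x| ≤ K) (hw : ∀ σ, HasDerivAt w (w' σ) σ) (hw' : Continuous w')
    (hw0 : ∀ σ, 0 ≤ w σ)
    (hV : Continuous (Function.uncurry V)) (hZ : Continuous (Function.uncurry Z))
    (h : ∀ t ∈ Icc t₀ t₁, IsPrimitive L (fun x => V x t) (fun x => c x * Z x t)) :
    let H := fun x => (∫ t in t₀..t₁, -β * w' (t - β * x) * V x t ^ 2) +
      c x * ∫ t in t₀..t₁, 2 * w (t - β * x) * V x t * Z x t
    r L * (∫ t in t₀..t₁, w (t - β * L) * V L t ^ 2)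
      - r 0 * (∫ t in t₀..t₁, w t * V 0 t ^ 2) ≤ (∫ x in (0 : ℝ)..L, r x * H x) ∧
    IntervalIntegrable (fun x => r x * H x) volume 0 L := by
  intro H
  have hwc : Continuous w := continuous_iff_continuousAt.2 fun σ => (hw σ).continuousAt
  have hV' : Continuous fun p : ℝ × ℝ => V p.1 p.2 := hV
  have hZ' : Continuous fun p : ℝ × ℝ => Z p.1 p.2 := hZ
  have key := IsPrimitive.integral_param (G := fun x t => w (t - β * x) * V x t ^ 2)
    (H₀ := fun x t => -β * w' (t - β * x) * V x t ^ 2)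
    (H₁ := fun x t => 2 * w (t - β * x) * V x t * Z x t) hL ht
    (by simp only [Function.uncurry_def]; fun_prop)
    (by simp only [Function.uncurry_def]; fun_prop)
    (by simp only [Function.uncurry_def]; fun_prop) hc hcK ?_
  · obtain ⟨hp, M, hM⟩ := key
    refine ⟨?_, ?_⟩
    · have := hp.antitone_mul_sub_le hL hr (fun x _ => intervalIntegral.integral_nonneg ht
        fun t _ => mul_nonneg (hw0 _) (sq_nonneg _)) (ae_of_all _ hM)
      simpa only [mul_zero, sub_zero] using this
    · have h1 := hp.integrable
      rw [intervalIntegrable_iff] at h1 ⊢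
      refine Integrable.bdd_mul (c := max |r 0| |r L|) h1 hr.measurable.aestronglyMeasurable ?_
      refine (ae_restrict_iff' measurableSet_uIoc).2 (ae_of_all _ fun z hz => ?_)
      rw [uIoc_of_le hL] at hz
      rw [Real.norm_eq_abs]
      exact abs_le_max_abs_abs (hr hz.2) (hr hz.1.le) |>.trans_eq (max_comm _ _)
  · intro t htt
    have p1 : IsPrimitive L (fun x => w (t - β * x)) (fun x => -β * w' (t - β * x)) := by
      refine isPrimitive_of_hasDerivAt (fun x => ?_) (by fun_prop)
      have : HasDerivAt (fun x => w (t - β * x)) (w' (t - β * x) * -(β * 1)) x :=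
        (hw (t - β * x)).comp x (((hasDerivAt_id x).const_mul β).const_sub t)
      exact this.congr_deriv (by ring)
    have p2 := p1.mul hL ((h t htt).mul hL (h t htt))
    refine IsPrimitive.congr (f' := _) (by simpa only [sq] using p2) (ae_of_all _ fun x _ => ?_) hL
    ring

/-- The sidewise energy estimate: `r = θρ` and `q = θ/a` are antitone, and the weight `w(t - βx)`
propagates with a speed not larger than the local one. -/
lemma IsSidewiseSystem.energy_le {L t₀ t₁ β K : ℝ} (hL : 0 ≤ L) (ht : t₀ ≤ t₁) (hβ : 0 ≤ β)
    {ρ α r q θ w w' : ℝ → ℝ} {V P Vt Pt : ℝ → ℝ → ℝ}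
    (hs : IsSidewiseSystem L t₀ t₁ ρ α V P Vt Pt)
    (hr : Antitone r) (hq : Antitone q) (hρm : Measurable ρ) (hαm : Measurable α)
    (hρK : ∀ x, |ρ x| ≤ K) (hαK : ∀ x, |α x| ≤ K)
    (hcoef : ∀ᵐ x, x ∈ Ioc 0 L → 0 ≤ θ x ∧ 0 ≤ ρ x ∧ 0 ≤ α x ∧ ρ x * α x ≤ β ^ 2 ∧
      r x = θ x * ρ x ∧ q x = θ x * α x ∧ θ x * ρ x * α x ≤ K)
    (hw : ∀ σ, HasDerivAt w (w' σ) σ) (hw' : Continuous w')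
    (hw0 : ∀ σ, 0 ≤ w σ) (hw1 : ∀ σ, w σ ≤ 1) (hw'0 : ∀ σ, 0 ≤ w' σ) (hwt : ∀ σ ≤ t₀, w σ = 0) :
    r L * (∫ t in t₀..t₁, w (t - β * L) * V L t ^ 2)
      + q L * (∫ t in t₀..t₁, w (t - β * L) * P L t ^ 2) ≤
    r 0 * (∫ t in t₀..t₁, w t * V 0 t ^ 2) + q 0 * (∫ t in t₀..t₁, w t * P 0 t ^ 2)
      + ∫ x in (0 : ℝ)..L, 2 * K * |V x t₁ * P x t₁| := by
  have hwc : Continuous w := continuous_iff_continuousAt.2 fun σ => (hw σ).continuousAt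
  obtain ⟨a1, i1⟩ := weighted_energy_le (β := β) hL ht hr hαm hαK hw hw' hw0 hs.contV hs.contPt hs.primV
  obtain ⟨a2, i2⟩ := weighted_energy_le (β := β) hL ht hq hρm hρK hw hw' hw0 hs.contP hs.contVt hs.primP
  have hcomp : ∀ {F : ℝ → ℝ → ℝ} (x : ℝ), Continuous (Function.uncurry F) → Continuous (F x) :=
    fun x hF => hF.comp (Continuous.prodMk_right x)
  have main := intervalIntegral.integral_mono_ae_restrict (μ := volume) hL (i1.add i2)
    (g := fun x => 2 * K * |V x t₁ * P x t₁|) ?_ ?_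
  · rw [intervalIntegral.integral_add i1 i2] at main
    linarith
  · refine Continuous.intervalIntegrable ?_ _ _
    have h1 : Continuous fun x => V x t₁ := hs.contV.comp (Continuous.prodMk_left t₁)
    have h2 : Continuous fun x => P x t₁ := hs.contP.comp (Continuous.prodMk_left t₁)
    fun_prop
  · rw [restrict_Ioc_eq_restrict_Icc.symm]
    refine (ae_restrict_iff' measurableSet_Ioc).2 ?_
    filter_upwards [hcoef] with x hx hxm
    obtain ⟨hθ, hρ, hα, hβ2, er, eq, hκ⟩ := hx hxm
    have hxI := Ioc_subset_Icc_self hxm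
    have cV := hcomp x hs.contV
    have cP := hcomp x hs.contP
    have cVt := hcomp x hs.contVt
    have cPt := hcomp x hs.contPt
    set κ := θ x * ρ x * α x with hκd
    have hκ0 : 0 ≤ κ := by positivity
    have ftc : ∫ t in t₀..t₁, (w' (t - β * x) * (V x t * P x t)
        + w (t - β * x) * (Vt x t * P x t + V x t * Pt x t))
        = w (t₁ - β * x) * (V x t₁ * P x t₁) - w (t₀ - β * x) * (V x t₀ * P x t₀) := by
      refine intervalIntegral.integral_eq_sub_of_hasDerivAt
        (f := fun t => w (t - β * x) * (V x t * P x t)) (fun t htt => ?_)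
        (Continuous.intervalIntegrable (by fun_prop) _ _)
      rw [uIcc_of_le ht] at htt
      exact ((hw _).comp_sub_const t (β * x)).mul
        ((hs.derivV x hxI t htt).mul (hs.derivP x hxI t htt))
    rw [hwt (t₀ - β * x) (by nlinarith [hxI.1]), zero_mul, sub_zero] at ftc
    -- Both cross terms carry the same coefficient `κ = θρα`, so they add up to `2κ w (VP)_t`, which
    -- `ftc` integrates; there is no contribution at `t₀`, since `w(t₀ - βx) = 0`.
    have hsum : r x * ((∫ t in t₀..t₁, -β * w' (t - β * x) * V x t ^ 2) +
          α x * ∫ t in t₀..t₁, 2 * w (t - β * x) * V x t * Pt x t)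
        + q x * ((∫ t in t₀..t₁, -β * w' (t - β * x) * P x t ^ 2) +
          ρ x * ∫ t in t₀..t₁, 2 * w (t - β * x) * P x t * Vt x t)
        = 2 * κ * (w (t₁ - β * x) * (V x t₁ * P x t₁)) +
          ∫ t in t₀..t₁, -(w' (t - β * x) * θ x *
            (β * (ρ x * V x t ^ 2 + α x * P x t ^ 2) + 2 * (ρ x * α x) * (V x t * P x t))) := by
      rw [← ftc]
      simp only [← intervalIntegral.integral_const_mul]
      rw [← intervalIntegral.integral_add, ← intervalIntegral.integral_add,
        ← intervalIntegral.integral_const_mul, ← intervalIntegral.integral_const_mul,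
        ← intervalIntegral.integral_add, ← intervalIntegral.integral_add]
      · refine intervalIntegral.integral_congr fun t _ => ?_
        simp only [er, eq, hκd]
        ring
      all_goals exact Continuous.intervalIntegrable (by fun_prop) _ _
    have hneg : ∫ t in t₀..t₁, -(w' (t - β * x) * θ x *
            (β * (ρ x * V x t ^ 2 + α x * P x t ^ 2) + 2 * (ρ x * α x) * (V x t * P x t))) ≤ 0 := by
      rw [intervalIntegral.integral_neg, neg_nonpos]
      refine intervalIntegral.integral_nonneg ht fun t _ => ?_
      refine mul_nonneg (mul_nonneg (hw'0 _) hθ) ?_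
      have hm : √(ρ x) * √(α x) ≤ β := by
        rw [← Real.sqrt_mul hρ]
        exact Real.sqrt_le_iff.2 ⟨hβ, hβ2⟩
      -- With `m = √ρ` and `n = √α`, the form equals `(β - mn)((mV)² + (nP)²) + mn (mV + nP)²`, and
      -- `mn ≤ β`.
      set m := √(ρ x)
      set n := √(α x)
      have e1 : ρ x = m ^ 2 := (Real.sq_sqrt hρ).symm
      have e2 : α x = n ^ 2 := (Real.sq_sqrt hα).symm
      rw [e1, e2]
      have hm0 : 0 ≤ m := Real.sqrt_nonneg _
      have hn0 : 0 ≤ n := Real.sqrt_nonneg _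
      have s1 : 0 ≤ (β - m * n) * ((m * V x t) ^ 2 + (n * P x t) ^ 2) :=
        mul_nonneg (by linarith) (by positivity)
      have s2 : 0 ≤ m * n * (m * V x t + n * P x t) ^ 2 := by positivity
      nlinarith
    change r x * ((∫ t in t₀..t₁, -β * w' (t - β * x) * V x t ^ 2) +
          α x * ∫ t in t₀..t₁, 2 * w (t - β * x) * V x t * Pt x t)
        + q x * ((∫ t in t₀..t₁, -β * w' (t - β * x) * P x t ^ 2) +
          ρ x * ∫ t in t₀..t₁, 2 * w (t - β * x) * P x t * Vt x t) ≤ _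
    rw [hsum]
    have : κ * (w (t₁ - β * x) * (V x t₁ * P x t₁)) ≤ K * |V x t₁ * P x t₁| := by
      refine (mul_le_mul_of_nonneg_left
        (mul_le_mul_of_nonneg_left (le_abs_self _) (hw0 _)) hκ0).trans ?_
      exact mul_le_mul hκ (mul_le_of_le_one_left (abs_nonneg _) (hw1 _))
        (mul_nonneg (hw0 _) (abs_nonneg _)) (hκ0.trans hκ)
    linarith

/-! ### Antitone weights from coefficients of bounded variation. -/

/-- A monotone function on `(0,L)` with values in `[lo,hi]`, extended to the line. -/
lemma monotone_extend {L lo hi : ℝ} (hle : lo ≤ hi) {f : ℝ → ℝ} (hf : MonotoneOn f (Ioo 0 L))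
    (hb : ∀ x ∈ Ioo 0 L, f x ∈ Icc lo hi) :
    Monotone fun x => if x ≤ 0 then lo else if L ≤ x then hi else f x := by
  intro x y hxy
  dsimp only
  by_cases x0 : x ≤ 0
  · rw [if_pos x0]
    split_ifs with y0 yL
    exacts [le_rfl, hle, (hb y ⟨not_le.1 y0, not_le.1 yL⟩).1]
  have y0 : ¬ y ≤ 0 := fun h => x0 (hxy.trans h)
  by_cases yL : L ≤ y
  · rw [if_neg x0, if_neg y0, if_pos yL]
    split_ifs with xL
    exacts [le_rfl, (hb x ⟨not_le.1 x0, not_le.1 xL⟩).2]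
  have xL : ¬ L ≤ x := fun h => yL (h.trans hxy)
  rw [if_neg x0, if_neg y0, if_neg xL, if_neg yL]
  exact hf ⟨not_le.1 x0, not_le.1 xL⟩ ⟨not_le.1 y0, not_le.1 yL⟩ hxy

/-- An antitone function on `(0,L)` with values in `[lo,hi]`, extended to the line. -/
lemma antitone_extend {L lo hi : ℝ} (hle : lo ≤ hi) {f : ℝ → ℝ} (hf : AntitoneOn f (Ioo 0 L))
    (hb : ∀ x ∈ Ioo 0 L, f x ∈ Icc lo hi) :
    Antitone fun x => if x ≤ 0 then hi else if L ≤ x then lo else f x := by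
  have := (monotone_extend (L := L) (neg_le_neg hle) (f := fun x => -f x) hf.neg
    (fun x hx => ⟨neg_le_neg (hb x hx).2, neg_le_neg (hb x hx).1⟩)).neg
  convert this using 2
  split_ifs <;> simp

/-- A coefficient of bounded variation has a bounded measurable representative whose increments
are controlled by a bounded monotone function. -/
lemma MemBV.exists_representative {L c₀ c₁ : ℝ} (hL : 0 < L) {c : ℝ → ℝ} (hc : MemBV 0 L c)
    (hb : ∀ᵐ x ∂(volume.restrict (Ioo 0 L)), c₀ ≤ c x ∧ c x ≤ c₁) :
    ∃ (f m : ℝ → ℝ) (N : ℝ), Measurable f ∧ (∀ x, c₀ ≤ f x ∧ f x ≤ c₁) ∧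
      c =ᵐ[volume.restrict (Ioo 0 L)] f ∧ MonotoneOn m (Ioo 0 L) ∧
      (∀ x ∈ Ioo 0 L, m x ∈ Icc 0 N) ∧
      ∀ x ∈ Ioo 0 L, ∀ y ∈ Ioo 0 L, x ≤ y → |f y - f x| ≤ m y - m x := by
  obtain ⟨g, hg, hcg⟩ := hc
  have hle : c₀ ≤ c₁ := by
    have : (volume.restrict (Ioo 0 L)) ≠ 0 := by simp [Measure.restrict_eq_zero, hL]
    have : (ae (volume.restrict (Ioo 0 L))).NeBot := ae_neBot.2 this
    obtain ⟨x, hx⟩ := hb.exists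
    exact hx.1.trans hx.2
  have hmid : L / 2 ∈ Ioo 0 L := ⟨by linarith, by linarith⟩
  set M := (eVariationOn g (Ioo 0 L)).toReal with hM
  set v := variationOnFromTo g (Ioo 0 L) (L / 2) with hv
  have hlg := hg.locallyBoundedVariationOn
  have hvm : MonotoneOn v (Ioo 0 L) := variationOnFromTo.monotoneOn hlg hmid
  -- Truncation to `[c₀,c₁]` makes the bounds hold everywhere and is 1-Lipschitz, so it does not
  -- increase the variation.
  set F : ℝ → ℝ := fun x => max c₀ (min c₁ (g x)) with hF
  have hFg : ∀ x y, |F y - F x| ≤ |g y - g x| := by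
    intro x y
    simp only [hF]
    refine (abs_max_sub_max_le_max _ _ _ _).trans ?_
    rw [sub_self, abs_zero]
    refine max_le (abs_nonneg _) ?_
    refine (abs_min_sub_min_le_max _ _ _ _).trans ?_
    rw [sub_self, abs_zero]
    exact max_le (abs_nonneg _) le_rfl
  have hinc : ∀ x ∈ Ioo 0 L, ∀ y ∈ Ioo 0 L, x ≤ y → |F y - F x| ≤ v y - v x := by
    intro x hx y hy hxy
    refine (hFg x y).trans ?_
    have := variationOnFromTo.abs_sub_le_sub_of_le hlg hmid hx hy hxy
    exact this
  -- The variation `v` is signed and based at the interior point `L/2`. Since `|v| ≤ M`, the shift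
  -- by `M` puts it in `[0, 2M]`.
  refine ⟨(Ioo 0 L).piecewise F fun _ => c₀, fun x => M + v x, 2 * M, ?_, ?_, ?_, ?_, ?_, ?_⟩
  · refine measurable_of_restrict_of_restrict_compl (s := Ioo 0 L) measurableSet_Ioo ?_ ?_
    · rw [domRestrict_piecewise]
      -- Measurability by the Jordan decomposition `F = (F + v) - v`.
      have h1 : Monotone fun x : Ioo 0 L => F x + v x := by
        intro x y hxy
        have := (abs_le.1 (hinc x x.2 y y.2 hxy)).1
        dsimp only; linarith
      have h2 : Monotone fun x : Ioo 0 L => v x := fun x y hxy => hvm x.2 y.2 hxy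
      have := h1.measurable.sub h2.measurable
      convert this using 1
      ext x; simp
    · rw [domRestrict_piecewise_compl]
      exact measurable_const
  · intro x
    by_cases hx : x ∈ Ioo 0 L
    · rw [piecewise_eq_of_mem _ _ _ hx]
      exact ⟨le_max_left _ _, max_le hle (min_le_left _ _)⟩
    · rw [piecewise_eq_of_notMem _ _ _ hx]
      exact ⟨le_rfl, hle⟩
  · filter_upwards [hb, hcg, ae_restrict_mem measurableSet_Ioo] with x hx hxg hxm
    rw [piecewise_eq_of_mem _ _ _ hxm]
    simp only [hF]
    rw [← hxg, min_eq_right hx.2, max_eq_right hx.1]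
  · exact fun x hx y hy hxy => by simpa using hvm hx hy hxy
  · intro x _
    have := abs_le.1 (variationOnFromTo.abs_le_eVariationOn hg (a := L / 2) (b := x))
    exact ⟨by linarith [this.1], by linarith [this.2]⟩
  · intro x hx y hy hxy
    rw [piecewise_eq_of_mem _ _ _ hx, piecewise_eq_of_mem _ _ _ hy, add_sub_add_left_eq_sub]
    exact hinc x hx y hy hxy

/-- Exponential weights make coefficients of bounded variation antitone. -/
lemma antitoneOn_mul_exp {L c₀ : ℝ} (hc₀ : 0 < c₀) {f m n : ℝ → ℝ} (hf : ∀ x, c₀ ≤ f x)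
    (hm : ∀ x ∈ Ioo 0 L, ∀ y ∈ Ioo 0 L, x ≤ y → |f y - f x| ≤ m y - m x)
    (hn : MonotoneOn n (Ioo 0 L)) :
    AntitoneOn (fun x => Real.exp (-(m x / c₀ + n x)) * f x) (Ioo 0 L) ∧
    AntitoneOn (fun x => Real.exp (-(m x / c₀ + n x)) * (f x)⁻¹) (Ioo 0 L) := by
  -- Since `f ≥ c₀`, the ratio of two values of `f`, in either order, is at most `1 + d ≤ exp d`
  -- with `d = (m y - m x)/c₀`.
  have key : ∀ x ∈ Ioo 0 L, ∀ y ∈ Ioo 0 L, x ≤ y →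
      f y ≤ f x * Real.exp (m y / c₀ - m x / c₀) ∧ f x ≤ f y * Real.exp (m y / c₀ - m x / c₀) := by
    intro x hx y hy hxy
    have h1 := hm x hx y hy hxy
    have h2 := Real.add_one_le_exp (m y / c₀ - m x / c₀)
    have h3 := abs_le.1 h1
    have h4 : 0 ≤ m y - m x := (abs_nonneg _).trans h1
    have h6 : m y - m x = c₀ * (m y / c₀ - m x / c₀) := by field_simp
    set d := m y / c₀ - m x / c₀
    have h5 : 0 ≤ d := by
      by_contra h; push Not at h; nlinarith
    have a1 := hf x
    have a2 := hf y
    constructor <;> nlinarith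
  constructor
  · intro x hx y hy hxy
    have h1 := (key x hx y hy hxy).1
    have h2 := hn hx hy hxy
    have e : Real.exp (-(m x / c₀ + n x)) =
        Real.exp (m y / c₀ - m x / c₀) * Real.exp (-(m y / c₀ + n x)) := by
      rw [← Real.exp_add]; ring_nf
    have hle : Real.exp (-(m y / c₀ + n y)) ≤ Real.exp (-(m y / c₀ + n x)) :=
      Real.exp_le_exp.2 (by linarith)
    calc Real.exp (-(m y / c₀ + n y)) * f y
        ≤ Real.exp (-(m y / c₀ + n x)) * (f x * Real.exp (m y / c₀ - m x / c₀)) :=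
          mul_le_mul hle h1 (by linarith [hf y]) (Real.exp_pos _).le
      _ = Real.exp (-(m x / c₀ + n x)) * f x := by rw [e]; ring
  · intro x hx y hy hxy
    have h1 := (key x hx y hy hxy).2
    have h2 := hn hx hy hxy
    have px : 0 < f x := hc₀.trans_le (hf x)
    have py : 0 < f y := hc₀.trans_le (hf y)
    have e : Real.exp (-(m x / c₀ + n x)) =
        Real.exp (m y / c₀ - m x / c₀) * Real.exp (-(m y / c₀ + n x)) := by
      rw [← Real.exp_add]; ring_nf
    have hle : Real.exp (-(m y / c₀ + n y)) ≤ Real.exp (-(m y / c₀ + n x)) :=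
      Real.exp_le_exp.2 (by linarith)
    dsimp only
    rw [← div_eq_mul_inv, ← div_eq_mul_inv, div_le_div_iff₀ py px, e]
    calc Real.exp (-(m y / c₀ + n y)) * f x
        ≤ Real.exp (-(m y / c₀ + n x)) * (f y * Real.exp (m y / c₀ - m x / c₀)) :=
          mul_le_mul hle h1 px.le (Real.exp_pos _).le
      _ = _ := by ring

/-- Antitone weights for the sidewise energy. -/
lemma exists_weights {L ρ₀ ρ₁ a₀ a₁ Nρ Na : ℝ} (hρ₀ : 0 < ρ₀) (ha₀ : 0 < a₀)
    {ρ a mρ ma : ℝ → ℝ} (hρ : ∀ x, ρ₀ ≤ ρ x ∧ ρ x ≤ ρ₁) (ha : ∀ x, a₀ ≤ a x ∧ a x ≤ a₁)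
    (mρm : MonotoneOn mρ (Ioo 0 L)) (mρb : ∀ x ∈ Ioo 0 L, mρ x ∈ Icc 0 Nρ)
    (hmρ : ∀ x ∈ Ioo 0 L, ∀ y ∈ Ioo 0 L, x ≤ y → |ρ y - ρ x| ≤ mρ y - mρ x)
    (mam : MonotoneOn ma (Ioo 0 L)) (mab : ∀ x ∈ Ioo 0 L, ma x ∈ Icc 0 Na)
    (hma : ∀ x ∈ Ioo 0 L, ∀ y ∈ Ioo 0 L, x ≤ y → |a y - a x| ≤ ma y - ma x) :
    ∃ r q θ : ℝ → ℝ, Antitone r ∧ Antitone q ∧ 0 < r L ∧ 0 < q L ∧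
      ∀ x ∈ Ioo 0 L, 0 ≤ θ x ∧ θ x ≤ 1 ∧ r x = θ x * ρ x ∧ q x = θ x * (a x)⁻¹ := by
  -- One `θ` has to serve both weights. For each of them, the exponent belonging to the other
  -- coefficient is a harmless additional monotone term.
  set θ : ℝ → ℝ := fun x => Real.exp (-(mρ x / ρ₀ + ma x / a₀)) with hθ
  have m1 : MonotoneOn (fun x => mρ x / ρ₀) (Ioo 0 L) :=
    fun x hx y hy h => div_le_div_of_nonneg_right (mρm hx hy h) hρ₀.le
  have m2 : MonotoneOn (fun x => ma x / a₀) (Ioo 0 L) :=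
    fun x hx y hy h => div_le_div_of_nonneg_right (mam hx hy h) ha₀.le
  have hr : AntitoneOn (fun x => θ x * ρ x) (Ioo 0 L) :=
    (antitoneOn_mul_exp hρ₀ (fun x => (hρ x).1) hmρ m2).1
  have hq : AntitoneOn (fun x => θ x * (a x)⁻¹) (Ioo 0 L) := by
    have := (antitoneOn_mul_exp ha₀ (fun x => (ha x).1) hma m1).2
    simpa only [hθ, add_comm] using this
  set lo := Real.exp (-(Nρ / ρ₀ + Na / a₀)) with hlo
  have lop : 0 < lo := Real.exp_pos _
  have θb : ∀ x ∈ Ioo 0 L, lo ≤ θ x ∧ θ x ≤ 1 := by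
    intro x hx
    have b1 := mρb x hx
    have b2 := mab x hx
    refine ⟨Real.exp_le_exp.2 ?_, Real.exp_le_one_iff.2 ?_⟩
    · have := div_le_div_of_nonneg_right b1.2 hρ₀.le
      have := div_le_div_of_nonneg_right b2.2 ha₀.le
      linarith
    · have := div_nonneg b1.1 hρ₀.le
      have := div_nonneg b2.1 ha₀.le
      linarith
  have ρp : ∀ x, 0 < ρ x := fun x => hρ₀.trans_le (hρ x).1
  have ap : ∀ x, 0 < a x := fun x => ha₀.trans_le (ha x).1
  have hρ₁ : 0 < ρ₁ := (ρp 0).trans_le (hρ 0).2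
  have ha₁ : 0 < a₁ := (ap 0).trans_le (ha 0).2
  have ha01 : a₀ ≤ a₁ := (ha 0).1.trans (ha 0).2
  have hρ01 : ρ₀ ≤ ρ₁ := (hρ 0).1.trans (hρ 0).2
  -- The sign of `L` is not assumed, so `(0,L)` may be empty and `lo ≤ 1` cannot be read off from
  -- `θb`; hence `min lo 1`.
  refine ⟨_, _, θ, antitone_extend (lo := min lo 1 * ρ₀) (hi := ρ₁) ?_ hr ?_,
    antitone_extend (lo := min lo 1 * a₁⁻¹) (hi := a₀⁻¹) ?_ hq ?_, ?_, ?_, ?_⟩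
  · exact (mul_le_of_le_one_left hρ₀.le (min_le_right _ _)).trans hρ01
  · intro x hx
    have b := θb x hx
    exact ⟨mul_le_mul ((min_le_left _ _).trans b.1) (hρ x).1 hρ₀.le (lop.le.trans b.1),
      (mul_le_of_le_one_left (ρp x).le b.2).trans (hρ x).2⟩
  · exact (mul_le_of_le_one_left (by positivity) (min_le_right _ _)).trans
      (inv_anti₀ ha₀ ha01)
  · intro x hx
    have b := θb x hx
    have i1 : a₁⁻¹ ≤ (a x)⁻¹ := inv_anti₀ (ap x) (ha x).2
    have i2 : (a x)⁻¹ ≤ a₀⁻¹ := inv_anti₀ ha₀ (ha x).1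
    exact ⟨mul_le_mul ((min_le_left _ _).trans b.1) i1 (by positivity) (lop.le.trans b.1),
      (mul_le_of_le_one_left (by have := ap x; positivity) b.2).trans i2⟩
  · have : 0 < min lo 1 := lt_min lop one_pos
    split_ifs <;> simp_all
  · have : 0 < min lo 1 := lt_min lop one_pos
    split_ifs <;> simp_all
  · intro x hx
    rw [if_neg (not_le.2 hx.1), if_neg (not_le.2 hx.2), if_neg (not_le.2 hx.1),
      if_neg (not_le.2 hx.2)]
    exact ⟨(Real.exp_pos _).le, (θb x hx).2, rfl, rfl⟩

/-! ### The space `L²(0,L)` and its integration operator. -/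

open scoped RealInnerProductSpace

/-- The Hilbert space `L²(0,L)`. -/
abbrev H (L : ℝ) : Type := Lp ℝ 2 (volume.restrict (Ioo (0 : ℝ) L))

/-- The class in `L²(0,L)` of the indicator of `(0,x)`. -/
def chi (L x : ℝ) : H L :=
  indicatorConstLp 2 (measurableSet_Ioo (a := (0 : ℝ)) (b := x)) (measure_ne_top _ _) (1 : ℝ)

lemma H.integrable {L : ℝ} (f : H L) : Integrable f (volume.restrict (Ioo 0 L)) :=
  (Lp.memLp f).integrable one_le_two

lemma integral_Ioo_eq {L : ℝ} (hL : 0 ≤ L) (f : ℝ → ℝ) :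
    ∫ x, f x ∂(volume.restrict (Ioo 0 L)) = ∫ x in (0 : ℝ)..L, f x := by
  rw [intervalIntegral.integral_of_le hL, integral_Ioc_eq_integral_Ioo]

lemma intervalIntegrable_of_Ioo {L : ℝ} (hL : 0 ≤ L) {f : ℝ → ℝ}
    (hf : Integrable f (volume.restrict (Ioo 0 L))) : IntervalIntegrable f volume 0 L := by
  rw [intervalIntegrable_iff_integrableOn_Ioo_of_le hL]
  exact hf

/-- Point values of `ψ(·,t)`, the primitive of `ψ_x(·,t)`, thus become bounded linear functionals of
`ψ_x(·,t)`, which commute with time averages and time derivatives. -/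
lemma inner_chi {L x : ℝ} (hx : x ∈ Icc 0 L) (f : H L) :
    ⟪chi L x, f⟫ = ∫ y in (0 : ℝ)..x, f y := by
  rw [chi, L2.inner_indicatorConstLp_one, Measure.restrict_restrict measurableSet_Ioo,
    inter_eq_left.2 (Ioo_subset_Ioo_right hx.2), intervalIntegral.integral_of_le hx.1,
    integral_Ioc_eq_integral_Ioo]

lemma isPrimitive_inner_chi {L : ℝ} (hL : 0 ≤ L) (f : H L) :
    IsPrimitive L (fun x => ⟪chi L x, f⟫) f := by
  refine ⟨intervalIntegrable_of_Ioo hL f.integrable, fun x hx => ?_⟩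
  rw [inner_chi hx, inner_chi ⟨le_rfl, hL⟩, intervalIntegral.integral_same, zero_add]

lemma chi_zero (L : ℝ) : chi L 0 = 0 := by
  have : (Ioo (0 : ℝ) 0) = ∅ := Ioo_self 0
  simp only [chi, this]
  exact indicatorConstLp_empty

lemma continuous_chi (L : ℝ) : Continuous (chi L) := by
  refine continuous_indicatorConstLp_set ENNReal.ofNat_ne_top fun x => ?_
  have hle : ∀ y, (volume.restrict (Ioo 0 L)) (symmDiff (Ioo 0 y) (Ioo 0 x)) ≤
      ENNReal.ofReal |y - x| := by
    intro y
    refine (Measure.restrict_apply_le _ _).trans ?_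
    have hsub : symmDiff (Ioo 0 y) (Ioo 0 x) ⊆ Icc (min y x) (max y x) := by
      rintro z (⟨h1, h2⟩ | ⟨h1, h2⟩)
      · have : x ≤ z := by by_contra h; exact h2 ⟨h1.1, not_le.1 h⟩
        exact ⟨(min_le_right _ _).trans this, h1.2.le.trans (le_max_left _ _)⟩
      · have : y ≤ z := by by_contra h; exact h2 ⟨h1.1, not_le.1 h⟩
        exact ⟨(min_le_left _ _).trans this, h1.2.le.trans (le_max_right _ _)⟩
    refine (measure_mono hsub).trans ?_
    rw [Real.volume_Icc, max_sub_min_eq_abs]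
    exact ENNReal.ofReal_le_ofReal (abs_sub_comm _ _).le
  refine tendsto_of_tendsto_of_tendsto_of_le_of_le tendsto_const_nhds ?_ (fun _ => zero_le) hle
  have : Tendsto (fun y => ENNReal.ofReal |y - x|) (𝓝 x) (𝓝 (ENNReal.ofReal |x - x|)) :=
    (ENNReal.continuous_ofReal.comp (by fun_prop : Continuous fun y => |y - x|)).tendsto x
  simpa using this

lemma norm_chi_le {L : ℝ} (x : ℝ) : ‖chi L x‖ ≤ ‖chi L L‖ := by
  refine Lp.norm_le_norm_of_ae_le ?_
  have h1 : (chi L x : ℝ → ℝ) =ᵐ[volume.restrict (Ioo 0 L)] _ := indicatorConstLp_coeFn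
  have h2 : (chi L L : ℝ → ℝ) =ᵐ[volume.restrict (Ioo 0 L)] _ := indicatorConstLp_coeFn
  filter_upwards [h1, h2, ae_restrict_mem measurableSet_Ioo] with y e1 e2 hy
  rw [e1, e2, indicator_of_mem hy]
  by_cases h : y ∈ Ioo 0 x
  · rw [indicator_of_mem h]
  · rw [indicator_of_notMem h]; simp

lemma memLp_inner_chi {L : ℝ} (f : H L) :
    MemLp (fun x => ⟪chi L x, f⟫) 2 (volume.restrict (Ioo 0 L)) := by
  refine MemLp.of_bound (C := ‖chi L L‖ * ‖f‖)
    ((continuous_chi L).inner continuous_const).aestronglyMeasurable (ae_of_all _ fun x => ?_)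
  exact (norm_inner_le_norm _ _).trans
    (mul_le_mul_of_nonneg_right (norm_chi_le x) (norm_nonneg _))

/-- The operator of integration from `0`, on `L²(0,L)`. -/
def primitiveCLM (L : ℝ) : H L →L[ℝ] H L :=
  LinearMap.mkContinuous
    { toFun := fun f => (memLp_inner_chi f).toLp _
      map_add' := fun f g => by
        rw [← MemLp.toLp_add]
        exact MemLp.toLp_congr _ _ (ae_of_all _ fun x => by simp [inner_add_right])
      map_smul' := fun c f => by
        rw [RingHom.id_apply, ← MemLp.toLp_const_smul]
        exact MemLp.toLp_congr _ _ (ae_of_all _ fun x => by simp [inner_smul_right]) }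
    ((measureUnivNNReal (volume.restrict (Ioo (0 : ℝ) L)) : ℝ) ^ (2 : ENNReal).toReal⁻¹ * ‖chi L L‖)
    (fun f => by
      rw [mul_assoc]
      refine Lp.norm_le_of_ae_bound (by positivity) ?_
      filter_upwards [MemLp.coeFn_toLp (memLp_inner_chi f)] with x hx
      simp only [LinearMap.coe_mk, AddHom.coe_mk]
      rw [hx]
      exact (norm_inner_le_norm _ _).trans
        (mul_le_mul_of_nonneg_right (norm_chi_le x) (norm_nonneg _)))

lemma primitiveCLM_coeFn {L : ℝ} (f : H L) :
    (primitiveCLM L f : ℝ → ℝ) =ᵐ[volume.restrict (Ioo 0 L)] fun x => ⟪chi L x, f⟫ :=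
  MemLp.coeFn_toLp (memLp_inner_chi f)

lemma memLp_mul {L K : ℝ} {c : ℝ → ℝ} (hc : Measurable c) (hK : ∀ x, |c x| ≤ K) {f : ℝ → ℝ}
    (hf : MemLp f 2 (volume.restrict (Ioo 0 L))) :
    MemLp (fun x => c x * f x) 2 (volume.restrict (Ioo 0 L)) := by
  refine hf.of_le_mul (c := K) (hc.aestronglyMeasurable.mul hf.1) (ae_of_all _ fun x => ?_)
  rw [norm_mul]
  exact mul_le_mul_of_nonneg_right (hK x) (norm_nonneg _)

/-- Multiplication by a bounded function, on `L²(0,L)`. -/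
lemma exists_mulCLM {L K : ℝ} {c : ℝ → ℝ} (hc : Measurable c) (hK : ∀ x, |c x| ≤ K) :
    ∃ A : H L →L[ℝ] H L,
      (∀ f : H L, (A f : ℝ → ℝ) =ᵐ[volume.restrict (Ioo 0 L)] fun x => c x * f x) ∧
      ∀ f : H L, ‖A f‖ ≤ K * ‖f‖ := by
  have hm : ∀ f : H L, MemLp (fun x => c x * f x) 2 (volume.restrict (Ioo 0 L)) :=
    fun f => memLp_mul hc hK (Lp.memLp f)
  have hb : ∀ f : H L, ‖(hm f).toLp _‖ ≤ K * ‖f‖ := by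
    intro f
    refine Lp.norm_le_mul_norm_of_ae_le_mul ?_
    filter_upwards [MemLp.coeFn_toLp (hm f)] with x hx
    rw [hx, norm_mul]
    exact mul_le_mul_of_nonneg_right (hK x) (norm_nonneg _)
  refine ⟨LinearMap.mkContinuous
    { toFun := fun f => (hm f).toLp _
      map_add' := fun f g => by
        rw [← MemLp.toLp_add]
        refine MemLp.toLp_congr _ _ ?_
        filter_upwards [Lp.coeFn_add f g] with x hx
        rw [hx]; simp [mul_add]
      map_smul' := fun r f => by
        rw [RingHom.id_apply, ← MemLp.toLp_const_smul]
        refine MemLp.toLp_congr _ _ ?_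
        filter_upwards [Lp.coeFn_smul r f] with x hx
        rw [hx]; simp [mul_left_comm] } K hb, fun f => MemLp.coeFn_toLp (hm f), hb⟩

/-! ### The du Bois-Reymond lemma and test functions. -/

/-- The lemma of du Bois-Reymond: `k` is constant if it is orthogonal to all `ξ'`. -/
lemma exists_ae_eq_const_of_integral_mul_deriv_eq_zero {L : ℝ} (hL : 0 < L) {k : ℝ → ℝ}
    (hk : IntervalIntegrable k volume 0 L)
    (h : ∀ ξ : ℝ → ℝ, ContDiff ℝ ∞ ξ → HasCompactSupport ξ → tsupport ξ ⊆ Ioo 0 L →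
      ∫ x in (0 : ℝ)..L, k x * deriv ξ x = 0) :
    ∃ c : ℝ, ∀ᵐ x, x ∈ Ioo 0 L → k x = c := by
  let b : ContDiffBump (L / 2) := ⟨L / 8, L / 4, by positivity, by linarith⟩
  set θ := b.normed volume with hθ
  have θs : ContDiff ℝ ∞ θ := b.contDiff_normed
  have θsupp : ∀ x, x ∉ Icc (L / 4) (3 * L / 4) → θ x = 0 := by
    intro x hx
    by_contra h0
    have : x ∈ Function.support (b.normed volume) := h0
    rw [b.support_normed_eq, Real.ball_eq_Ioo] at this
    refine hx ⟨?_, ?_⟩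
    · have := this.1; simp only [b] at this; linarith
    · have := this.2; simp only [b] at this; linarith
  have θint : ∀ s e : ℝ, s ≤ L / 4 → 3 * L / 4 ≤ e → ∫ x in s..e, θ x = 1 := by
    intro s e hs he
    rw [intervalIntegral.integral_of_le (by linarith),
      setIntegral_eq_integral_of_ae_compl_eq_zero, b.integral_normed]
    refine ae_of_all _ fun x hx => ?_
    by_cases hx' : x ∈ Icc (L / 4) (3 * L / 4)
    · rcases eq_or_lt_of_le (hs.trans hx'.1) with h | h
      · have : x = L / 4 := le_antisymm (h ▸ hs) hx'.1
        by_contra h0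
        have : x ∈ Function.support (b.normed volume) := h0
        rw [b.support_normed_eq, Real.ball_eq_Ioo] at this
        have := this.1; simp only [b] at this; linarith
      · exact absurd ⟨h, hx'.2.trans he⟩ hx
    · exact θsupp x hx'
  refine ⟨∫ x in (0 : ℝ)..L, k x * θ x, ?_⟩
  set c := ∫ x in (0 : ℝ)..L, k x * θ x with hc
  have := isOpen_Ioo.ae_eq_zero_of_integral_contDiff_smul_eq_zero (U := Ioo 0 L) (μ := volume)
    (f := fun x => k x - c) ?_ ?_
  · filter_upwards [this] with x hx hxm
    linarith [hx hxm]
  · refine (IntegrableOn.locallyIntegrableOn ?_)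
    refine Integrable.sub ?_ (integrableOn_const (by simp))
    exact (intervalIntegrable_iff_integrableOn_Ioo_of_le hL.le).1 hk
  · intro φ φs φc φt
    set m := ∫ x in (0 : ℝ)..L, φ x with hm
    obtain ⟨s, e, hs0, hsL, he0, heL, hφ⟩ : ∃ s e : ℝ, 0 < s ∧ s ≤ L / 4 ∧ 3 * L / 4 ≤ e ∧ e < L ∧
        ∀ x, x ∉ Icc s e → φ x = 0 := by
      have hcpt : IsCompact (tsupport φ) := φc
      rcases (tsupport φ).eq_empty_or_nonempty with he | hne
      · refine ⟨L / 4, 3 * L / 4, by positivity, le_rfl, le_rfl, by linarith, fun x _ => ?_⟩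
        exact image_eq_zero_of_notMem_tsupport (by simp [he])
      · obtain ⟨s, hs, hs'⟩ := hcpt.exists_isLeast hne
        obtain ⟨e, he, he'⟩ := hcpt.exists_isGreatest hne
        refine ⟨min s (L / 4), max e (3 * L / 4), lt_min (φt hs).1 (by positivity), min_le_right _ _,
          le_max_right _ _, max_lt (φt he).2 (by linarith), fun x hx => ?_⟩
        refine image_eq_zero_of_notMem_tsupport fun hxt => hx ⟨?_, ?_⟩
        · exact (min_le_left _ _).trans (hs' hxt)
        · exact (he' hxt).trans (le_max_left _ _)
    -- Subtracting `m θ` makes the integral zero, so the primitive `ξ` has compact support in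
    -- `(0,L)` and is admissible in `h`. Orthogonality to `ψ = ξ'` gives `∫ k φ = c ∫ φ`.
    set ψ : ℝ → ℝ := fun x => φ x - m * θ x with hψ
    have ψs : ContDiff ℝ ∞ ψ := φs.sub (contDiff_const.mul θs)
    have ψ0 : ∀ x, x ∉ Icc s e → ψ x = 0 := by
      intro x hx
      have : x ∉ Icc (L / 4) (3 * L / 4) := fun h => hx ⟨hsL.trans h.1, h.2.trans he0⟩
      simp only [hψ, hφ x hx, θsupp x this]; ring
    set ξ : ℝ → ℝ := fun x => ∫ y in (0 : ℝ)..x, ψ y with hξ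
    have ξd : ∀ x, HasDerivAt ξ (ψ x) x := fun x =>
      intervalIntegral.integral_hasDerivAt_right (ψs.continuous.intervalIntegrable _ _)
        (ψs.continuous.stronglyMeasurableAtFilter _ _) ψs.continuous.continuousAt
    have ξd' : deriv ξ = ψ := funext fun x => (ξd x).deriv
    have ξs : ContDiff ℝ ∞ ξ := by
      rw [contDiff_infty_iff_deriv, ξd']
      exact ⟨fun x => (ξd x).differentiableAt, ψs⟩
    have ψL : ∫ y in (0 : ℝ)..L, ψ y = 0 := by
      simp only [hψ]
      rw [intervalIntegral.integral_sub (φs.continuous.intervalIntegrable _ _)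
        ((θs.continuous.intervalIntegrable _ _).const_mul _), intervalIntegral.integral_const_mul,
        θint 0 L (by linarith) (by linarith)]
      simp [hm]
    have ξ0 : ∀ x, x ∉ Icc s e → ξ x = 0 := by
      intro x hx
      rcases lt_or_ge x s with h1 | h1
      · refine intervalIntegral.integral_zero_ae (ae_of_all _ fun y hy => ψ0 y fun hy' => ?_)
        rcases le_total 0 x with h0 | h0
        · rw [uIoc_of_le h0] at hy; linarith [hy.2, hy'.1]
        · rw [uIoc_of_ge h0] at hy; linarith [hy.2, hy'.1]
      · have hex : e < x := by by_contra h; exact hx ⟨h1, not_lt.1 h⟩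
        have : ξ x = (∫ y in (0 : ℝ)..L, ψ y) + ∫ y in L..x, ψ y :=
          (intervalIntegral.integral_add_adjacent_intervals
            (ψs.continuous.intervalIntegrable _ _) (ψs.continuous.intervalIntegrable _ _)).symm
        rw [this, ψL, zero_add]
        refine intervalIntegral.integral_zero_ae (ae_of_all _ fun y hy => ψ0 y fun hy' => ?_)
        rcases le_total L x with h0 | h0
        · rw [uIoc_of_le h0] at hy; linarith [hy.1, hy'.2]
        · rw [uIoc_of_ge h0] at hy; linarith [hy.1, hy'.2]
    have ξsub : Function.support ξ ⊆ Icc s e := fun x hx => by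
      by_contra h; exact hx (ξ0 x h)
    have ξts : tsupport ξ ⊆ Icc s e := closure_minimal ξsub isClosed_Icc
    have key := h ξ ξs (HasCompactSupport.of_support_subset_isCompact isCompact_Icc ξsub)
      (ξts.trans fun x hx => ⟨hs0.trans_le hx.1, hx.2.trans_lt heL⟩)
    rw [ξd'] at key
    have kφ : IntervalIntegrable (fun x => k x * φ x) volume 0 L :=
      hk.mul_continuousOn φs.continuous.continuousOn
    have kθ : IntervalIntegrable (fun x => k x * θ x) volume 0 L :=
      hk.mul_continuousOn θs.continuous.continuousOn
    have e1 : ∫ x in (0 : ℝ)..L, k x * ψ x = (∫ x in (0 : ℝ)..L, k x * φ x) - m * c := by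
      rw [hc, ← intervalIntegral.integral_const_mul, ← intervalIntegral.integral_sub kφ
        (kθ.const_mul _)]
      refine intervalIntegral.integral_congr fun x _ => ?_
      simp only [hψ]; ring
    have e2 : ∫ x, φ x • (k x - c) = ∫ x in (0 : ℝ)..L, (k x * φ x - c * φ x) := by
      rw [intervalIntegral.integral_of_le hL.le, setIntegral_eq_integral_of_ae_compl_eq_zero]
      · exact integral_congr_ae (ae_of_all _ fun x => by simp only [smul_eq_mul]; ring)
      · refine ae_of_all _ fun x hx => ?_
        rw [hφ x fun hx' => hx ⟨hs0.trans_le hx'.1, (hx'.2.trans_lt heL).le⟩]; ring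
    rw [e2, intervalIntegral.integral_sub kφ ((φs.continuous.intervalIntegrable _ _).const_mul _),
      intervalIntegral.integral_const_mul, ← hm]
    linarith

/-- `η ∈ C_c^∞(0,T)`. -/
structure IsTest (T : ℝ) (η : ℝ → ℝ) : Prop where
  smooth : ContDiff ℝ ∞ η
  compact : HasCompactSupport η
  tsupport_subset : tsupport η ⊆ Ioo 0 T

lemma IsTest.deriv {T : ℝ} {η : ℝ → ℝ} (h : IsTest T η) : IsTest T (deriv η) :=
  ⟨(contDiff_infty_iff_deriv.1 h.smooth).2, h.compact.deriv,
    (tsupport_deriv_subset (𝕜 := ℝ)).trans h.tsupport_subset⟩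

lemma IsTest.eq_zero {T : ℝ} {η : ℝ → ℝ} (h : IsTest T η) {x : ℝ} (hx : x ∉ Ioo 0 T) : η x = 0 :=
  image_eq_zero_of_notMem_tsupport fun h' => hx (h.tsupport_subset h')

lemma IsTest.hasDerivAt {T : ℝ} {η : ℝ → ℝ} (h : IsTest T η) (x : ℝ) :
    HasDerivAt η (_root_.deriv η x) x :=
  ((contDiff_infty_iff_deriv.1 h.smooth).1 x).hasDerivAt

lemma IsTest.integrable_smul {T : ℝ} {η : ℝ → ℝ} (h : IsTest T η) {E : Type*}
    [NormedAddCommGroup E] [NormedSpace ℝ E] {f : ℝ → E} (hf : Continuous f) :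
    Integrable fun τ => η τ • f τ :=
  (h.smooth.continuous.smul hf).integrable_of_hasCompactSupport h.compact.smul_right

lemma IsTest.memLp {L : ℝ} {ξ : ℝ → ℝ} (h : IsTest L ξ) :
    MemLp ξ 2 (volume.restrict (Ioo 0 L)) :=
  (h.smooth.continuous.memLp_of_hasCompactSupport h.compact).restrict _

/-- Differentiability of `f` on `(0,T)` suffices: near a point outside `tsupport η` the product `η
f` vanishes identically. -/
lemma IsTest.integral_deriv_smul {T : ℝ} {η : ℝ → ℝ} (h : IsTest T η) {E : Type*}
    [NormedAddCommGroup E] [NormedSpace ℝ E] {f f' : ℝ → E} (hf : Continuous f)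
    (hf' : Continuous f') (hd : ∀ τ ∈ Ioo 0 T, HasDerivAt f (f' τ) τ) :
    ∫ τ, _root_.deriv η τ • f τ = -∫ τ, η τ • f' τ := by
  have hder : ∀ τ, HasDerivAt (fun τ => η τ • f τ) (η τ • f' τ + _root_.deriv η τ • f τ) τ := by
    intro τ
    by_cases hτ : τ ∈ tsupport η
    · exact (h.hasDerivAt τ).smul (hd τ (h.tsupport_subset hτ))
    · have hev : η =ᶠ[𝓝 τ] 0 := notMem_tsupport_iff_eventuallyEq.1 hτ
      rw [hev.deriv_eq, hev.eq_of_nhds]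
      simp only [Pi.zero_apply, zero_smul, Pi.zero_def, deriv_const, add_zero]
      refine (hasDerivAt_const τ (0 : E)).congr_of_eventuallyEq ?_
      filter_upwards [hev] with x hx
      simp [hx]
  have i1 := h.integrable_smul hf'
  have i2 := h.deriv.integrable_smul hf
  have := integral_eq_zero_of_hasDerivAt_of_integrable hder (i1.add i2) (h.integrable_smul hf)
  rw [integral_add i1 i2] at this
  exact eq_neg_of_add_eq_zero_right this

/-! ### The weak wave equation and the averaged flux. -/

/-- The weak wave equation for the curves `D = ψ_x` and `W = ψ_t` in `L²(0,L)`, where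
`ψ(x,t) = ∫_0^x ψ_x(·,t)`. -/
structure IsWeakWave (L T : ℝ) (ρ a : ℝ → ℝ) (D W : ℝ → H L) : Prop where
  contD : Continuous D
  contW : Continuous W
  hasDerivAt : ∀ τ ∈ Ioo 0 T, HasDerivAt (fun τ => primitiveCLM L (D τ)) (W τ) τ
  equation : ∀ ξ η : ℝ → ℝ, IsTest L ξ → IsTest T η →
    ∫ τ, (-(deriv η τ * ∫ x in (0 : ℝ)..L, ρ x * W τ x * ξ x) +
      η τ * ∫ x in (0 : ℝ)..L, a x * D τ x * deriv ξ x) = 0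

/-- The continuous representative of `a ψ_x`, for the time averages `e₀` of `ψ_x` and `e₂` of
`∂_t² ψ_x`. Here `A` and `R` are the multiplications by `a` and `ρ`. -/
def flux (L : ℝ) (A R : H L →L[ℝ] H L) (x : ℝ) (e₀ e₂ : H L) : ℝ :=
  L⁻¹ * ⟪chi L L, A e₀ - primitiveCLM L (R (primitiveCLM L e₂))⟫ +
    ⟪chi L x, R (primitiveCLM L e₂)⟫

lemma inner_toLp_eq {L : ℝ} (hL : 0 ≤ L) {ξ : ℝ → ℝ}
    (hξ : MemLp ξ 2 (volume.restrict (Ioo 0 L))) (f : H L) :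
    ⟪hξ.toLp ξ, f⟫ = ∫ x in (0 : ℝ)..L, f x * ξ x := by
  rw [L2.inner_def, ← integral_Ioo_eq hL]
  refine integral_congr_ae ?_
  filter_upwards [hξ.coeFn_toLp] with x hx
  simp [hx]

lemma inner_toLp_mul_eq {L : ℝ} (hL : 0 ≤ L) {c ξ : ℝ → ℝ}
    (hξ : MemLp ξ 2 (volume.restrict (Ioo 0 L))) {A : H L →L[ℝ] H L}
    (hA : ∀ f : H L, (A f : ℝ → ℝ) =ᵐ[volume.restrict (Ioo 0 L)] fun x => c x * f x) (f : H L) :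
    ⟪hξ.toLp ξ, A f⟫ = ∫ x in (0 : ℝ)..L, c x * f x * ξ x := by
  rw [inner_toLp_eq hL, ← integral_Ioo_eq hL, ← integral_Ioo_eq hL]
  refine integral_congr_ae ?_
  filter_upwards [hA f] with x hx
  rw [hx]

section WeakWave

variable {L T : ℝ} {ρ a : ℝ → ℝ} {D W : ℝ → H L} {A R : H L →L[ℝ] H L}

lemma IsWeakWave.integral_deriv_deriv (h : IsWeakWave L T ρ a D W) {η : ℝ → ℝ} (hη : IsTest T η) :
    primitiveCLM L (∫ τ, deriv η τ • D τ) = -∫ τ, η τ • W τ := by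
  rw [← ContinuousLinearMap.integral_comp_comm _ (hη.deriv.integrable_smul h.contD),
    ← hη.integral_deriv_smul ((primitiveCLM L).continuous.comp h.contD) h.contW h.hasDerivAt]
  simp

/-- One more integration by parts in time eliminates `W`. What is left is an ordinary differential
equation in `x` in weak form, `(a e₀)_x = ρ ∫_0^x e₂`, for the averages `e₀`, `e₂` of `ψ_x` against
`η` and `η''`. -/
lemma IsWeakWave.inner_test_eq_zero (hL : 0 ≤ L) (h : IsWeakWave L T ρ a D W)
    (hA : ∀ f : H L, (A f : ℝ → ℝ) =ᵐ[volume.restrict (Ioo 0 L)] fun x => a x * f x)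
    (hR : ∀ f : H L, (R f : ℝ → ℝ) =ᵐ[volume.restrict (Ioo 0 L)] fun x => ρ x * f x)
    {ξ η : ℝ → ℝ} (hξ : IsTest L ξ) (hη : IsTest T η) :
    ⟪hξ.memLp.toLp ξ, R (primitiveCLM L (∫ τ, deriv (deriv η) τ • D τ))⟫ +
      ⟪hξ.deriv.memLp.toLp (deriv ξ), A (∫ τ, η τ • D τ)⟫ = 0 := by
  rw [h.integral_deriv_deriv hη.deriv, map_neg, inner_neg_right,
    ← ContinuousLinearMap.integral_comp_comm _ (hη.deriv.integrable_smul h.contW),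
    ← ContinuousLinearMap.integral_comp_comm _ (hη.integrable_smul h.contD),
    ← integral_inner, ← integral_inner, ← integral_neg, ← integral_add]
  · refine Eq.trans (integral_congr_ae (ae_of_all _ fun τ => ?_)) (h.equation ξ η hξ hη)
    simp only [map_smul, inner_smul_right]
    rw [inner_toLp_mul_eq hL _ hA, inner_toLp_mul_eq hL _ hR]
  · simp only [map_smul, inner_smul_right]
    exact (hη.deriv.integrable_smul (continuous_const.inner (R.continuous.comp h.contW))).neg
  · simp only [map_smul, inner_smul_right]
    exact hη.integrable_smul (continuous_const.inner (A.continuous.comp h.contD))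
  · simp only [map_smul]
    exact hη.integrable_smul (A.continuous.comp h.contD)
  · simp only [map_smul]
    exact hη.deriv.integrable_smul (R.continuous.comp h.contW)

/-- The averaged flux `a ψ_x` is absolutely continuous. -/
lemma IsWeakWave.ae_eq_flux (hL : 0 < L) (h : IsWeakWave L T ρ a D W)
    (hA : ∀ f : H L, (A f : ℝ → ℝ) =ᵐ[volume.restrict (Ioo 0 L)] fun x => a x * f x)
    (hR : ∀ f : H L, (R f : ℝ → ℝ) =ᵐ[volume.restrict (Ioo 0 L)] fun x => ρ x * f x)
    {η : ℝ → ℝ} (hη : IsTest T η) :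
    (A (∫ τ, η τ • D τ) : ℝ → ℝ) =ᵐ[volume.restrict (Ioo 0 L)] fun x =>
      flux L A R x (∫ τ, η τ • D τ) (∫ τ, deriv (deriv η) τ • D τ) := by
  set e₀ := ∫ τ, η τ • D τ
  set g := R (primitiveCLM L (∫ τ, deriv (deriv η) τ • D τ)) with hg
  set G : ℝ → ℝ := fun x => ⟪chi L x, g⟫ with hG
  have Gc : Continuous G := (continuous_chi L).inner continuous_const
  have Gp : IsPrimitive L G g := isPrimitive_inner_chi hL.le g
  have iA := intervalIntegrable_of_Ioo hL.le (A e₀).integrable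
  have iG : IntervalIntegrable G volume 0 L := Gc.intervalIntegrable _ _
  -- Integrating the zeroth-order term by parts in `x` shows that `a e₀ - G` is orthogonal to every
  -- `ξ'`. The resulting constant is its mean over `(0,L)`, the first term of `flux`.
  obtain ⟨c, hc⟩ := exists_ae_eq_const_of_integral_mul_deriv_eq_zero hL (k := fun x => A e₀ x - G x)
    (iA.sub iG) fun ξ ξ1 ξ2 ξ3 => by
      have hξ : IsTest L ξ := ⟨ξ1, ξ2, ξ3⟩
      have key := h.inner_test_eq_zero hL.le hA hR hξ hη
      rw [inner_toLp_eq hL.le, inner_toLp_eq hL.le] at key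
      have ξp := isPrimitive_of_hasDerivAt (L := L) hξ.hasDerivAt hξ.deriv.smooth.continuous
      have iGξ : IntervalIntegrable (fun x => G x * deriv ξ x) volume 0 L :=
        (Gc.mul hξ.deriv.smooth.continuous).intervalIntegrable _ _
      have hp := (Gp.mul hL.le ξp).eq L ⟨hL.le, le_rfl⟩
      rw [hξ.eq_zero (x := L) (by simp), hξ.eq_zero (x := 0) (by simp), mul_zero, mul_zero, zero_add,
        intervalIntegral.integral_add (Gp.integrable.mul_continuousOn ξ1.continuous.continuousOn)
        iGξ] at hp
      have : ∫ x in (0 : ℝ)..L, (A e₀ x - G x) * deriv ξ x =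
          (∫ x in (0 : ℝ)..L, A e₀ x * deriv ξ x) - ∫ x in (0 : ℝ)..L, G x * deriv ξ x := by
        rw [← intervalIntegral.integral_sub
          (iA.mul_continuousOn hξ.deriv.smooth.continuous.continuousOn)
          iGξ]
        exact intervalIntegral.integral_congr fun x _ => by ring
      rw [this]
      linarith
  have hcL : L * c = ⟪chi L L, A e₀ - primitiveCLM L g⟫ := by
    rw [inner_sub_right, inner_chi ⟨hL.le, le_rfl⟩, inner_chi ⟨hL.le, le_rfl⟩]
    have e1 : ∫ y in (0 : ℝ)..L, primitiveCLM L g y = ∫ y in (0 : ℝ)..L, G y := by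
      rw [← integral_Ioo_eq hL.le, ← integral_Ioo_eq hL.le]
      exact integral_congr_ae (primitiveCLM_coeFn g)
    rw [e1, ← intervalIntegral.integral_sub iA iG, ← integral_Ioo_eq hL.le,
      integral_congr_ae ((ae_restrict_iff' measurableSet_Ioo).2 hc)]
    simp [hL.le]
  have hcL' : c = L⁻¹ * ⟪chi L L, A e₀ - primitiveCLM L g⟫ := by
    rw [← hcL]; field_simp
  filter_upwards [(ae_restrict_iff' measurableSet_Ioo).2 hc] with x hx
  rw [flux, ← hg, ← hcL', ← hx]
  ring

end WeakWave

/-! ### Time averages solve the sidewise system. -/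

/-- The time average `∫ f(t - τ) D(τ) dτ`. -/
def timeAvg {L : ℝ} (f : ℝ → ℝ) (D : ℝ → H L) (t : ℝ) : H L :=
  ∫ τ, f (t - τ) • D τ

lemma timeAvg_eq_convolution {L : ℝ} (f : ℝ → ℝ) (D : ℝ → H L) :
    timeAvg f D = convolution f D (ContinuousLinearMap.lsmul ℝ ℝ) volume := by
  ext1 t
  rw [convolution_lsmul_swap, timeAvg]

lemma continuous_timeAvg {L : ℝ} {f : ℝ → ℝ} {D : ℝ → H L} (hf : ContDiff ℝ ∞ f)
    (hc : HasCompactSupport f) (hD : Continuous D) : Continuous (timeAvg f D) := by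
  rw [timeAvg_eq_convolution]
  exact hc.continuous_convolution_left _ hf.continuous hD.locallyIntegrable

lemma hasDerivAt_timeAvg {L : ℝ} {f : ℝ → ℝ} {D : ℝ → H L} (hf : ContDiff ℝ ∞ f)
    (hc : HasCompactSupport f) (hD : Continuous D) (t : ℝ) :
    HasDerivAt (timeAvg f D) (timeAvg (deriv f) D t) t := by
  rw [timeAvg_eq_convolution, timeAvg_eq_convolution]
  exact hc.hasDerivAt_convolution_left _ (hf.of_le (by simp)) hD.locallyIntegrable t

lemma isTest_comp_sub {T ε t : ℝ} {f : ℝ → ℝ} (hf : ContDiff ℝ ∞ f)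
    (hs : tsupport f ⊆ Icc (-ε) ε) (ht : t ∈ Ioo ε (T - ε)) : IsTest T fun τ => f (t - τ) := by
  have hsupp : Function.support (fun τ => f (t - τ)) ⊆ Icc (t - ε) (t + ε) := by
    intro τ hτ
    have := hs (subset_tsupport f hτ)
    exact ⟨by linarith [this.2], by linarith [this.1]⟩
  refine ⟨hf.comp (contDiff_const.sub contDiff_id),
    HasCompactSupport.of_support_subset_isCompact isCompact_Icc hsupp, ?_⟩
  refine (closure_minimal hsupp isClosed_Icc).trans fun τ hτ => ?_
  exact ⟨by linarith [hτ.1, ht.1], by linarith [hτ.2, ht.2]⟩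

lemma deriv_comp_const_sub' (f : ℝ → ℝ) (t : ℝ) :
    deriv (fun τ => f (t - τ)) = fun τ => -deriv f (t - τ) := by
  ext τ
  exact deriv_comp_const_sub f t τ

lemma continuous_flux (L : ℝ) (A R : H L →L[ℝ] H L) {e₀ e₂ : ℝ → H L} (h₀ : Continuous e₀)
    (h₂ : Continuous e₂) :
    Continuous (Function.uncurry fun x t => flux L A R x (e₀ t) (e₂ t)) := by
  have hc := continuous_chi L
  have h₀' : Continuous fun p : ℝ × ℝ => e₀ p.2 := h₀.comp continuous_snd
  have h₂' : Continuous fun p : ℝ × ℝ => e₂ p.2 := h₂.comp continuous_snd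
  have h1 : Continuous fun p : ℝ × ℝ => R (primitiveCLM L (e₂ p.2)) :=
    R.continuous.comp ((primitiveCLM L).continuous.comp h₂')
  simp only [Function.uncurry_def, flux]
  refine (continuous_const.mul (continuous_const.inner ?_)).add
    ((hc.comp continuous_fst).inner h1)
  exact (A.continuous.comp h₀').sub ((primitiveCLM L).continuous.comp h1)

lemma hasDerivAt_inner_const {L : ℝ} (c : H L) {e : ℝ → H L} {e' : H L} {t : ℝ}
    (h : HasDerivAt e e' t) : HasDerivAt (fun t => ⟪c, e t⟫) ⟪c, e'⟫ t :=
  ((innerSL ℝ c).hasFDerivAt.comp_hasDerivAt t h)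

lemma hasDerivAt_flux (L : ℝ) (A R : H L →L[ℝ] H L) (x : ℝ) {e₀ e₂ : ℝ → H L} {e₀' e₂' : H L}
    {t : ℝ} (h₀ : HasDerivAt e₀ e₀' t) (h₂ : HasDerivAt e₂ e₂' t) :
    HasDerivAt (fun t => flux L A R x (e₀ t) (e₂ t)) (flux L A R x e₀' e₂') t := by
  have h1 : HasDerivAt (fun t => R (primitiveCLM L (e₂ t))) (R (primitiveCLM L e₂')) t :=
    R.hasFDerivAt.comp_hasDerivAt t ((primitiveCLM L).hasFDerivAt.comp_hasDerivAt t h₂)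
  have h2 : HasDerivAt (fun t => A (e₀ t)) (A e₀') t := A.hasFDerivAt.comp_hasDerivAt t h₀
  have h3 : HasDerivAt (fun t => primitiveCLM L (R (primitiveCLM L (e₂ t))))
    (primitiveCLM L (R (primitiveCLM L e₂'))) t := (primitiveCLM L).hasFDerivAt.comp_hasDerivAt t h1
  exact ((hasDerivAt_inner_const _ (h2.sub h3)).const_mul _).add (hasDerivAt_inner_const _ h1)

/-- A smooth kernel supported in `[-ε, ε]`. -/
structure IsKernel (ε : ℝ) (f : ℝ → ℝ) : Prop where
  smooth : ContDiff ℝ ∞ f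
  tsupport_subset : tsupport f ⊆ Icc (-ε) ε

lemma IsKernel.compact {ε : ℝ} {f : ℝ → ℝ} (h : IsKernel ε f) : HasCompactSupport f :=
  HasCompactSupport.of_support_subset_isCompact isCompact_Icc
    ((subset_tsupport f).trans h.tsupport_subset)

lemma IsKernel.deriv {ε : ℝ} {f : ℝ → ℝ} (h : IsKernel ε f) : IsKernel ε (deriv f) :=
  ⟨(contDiff_infty_iff_deriv.1 h.smooth).2,
    (tsupport_deriv_subset (𝕜 := ℝ)).trans h.tsupport_subset⟩

lemma IsKernel.isTest {ε T t : ℝ} {f : ℝ → ℝ} (h : IsKernel ε f) (ht : t ∈ Ioo ε (T - ε)) :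
    IsTest T fun τ => f (t - τ) :=
  isTest_comp_sub h.smooth h.tsupport_subset ht

lemma IsKernel.eq_zero {ε : ℝ} {f : ℝ → ℝ} (h : IsKernel ε f) {σ : ℝ} (hσ : σ ∉ Icc (-ε) ε) :
    f σ = 0 :=
  image_eq_zero_of_notMem_tsupport fun h' => hσ (h.tsupport_subset h')

section WeakWave

variable {L T : ℝ} {ρ a : ℝ → ℝ} {D W : ℝ → H L} {A R : H L →L[ℝ] H L}

lemma IsWeakWave.timeAvg_ae_eq_flux (hL : 0 < L) (h : IsWeakWave L T ρ a D W)
    (hA : ∀ f : H L, (A f : ℝ → ℝ) =ᵐ[volume.restrict (Ioo 0 L)] fun x => a x * f x)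
    (hR : ∀ f : H L, (R f : ℝ → ℝ) =ᵐ[volume.restrict (Ioo 0 L)] fun x => ρ x * f x)
    {ε t : ℝ} {f : ℝ → ℝ} (hf : IsKernel ε f) (ht : t ∈ Ioo ε (T - ε)) :
    (A (timeAvg f D t) : ℝ → ℝ) =ᵐ[volume.restrict (Ioo 0 L)] fun x =>
      flux L A R x (timeAvg f D t) (timeAvg (deriv (deriv f)) D t) := by
  have e : deriv (deriv fun τ => f (t - τ)) = fun τ => deriv (deriv f) (t - τ) := by
    rw [deriv_comp_const_sub']
    ext τ
    rw [deriv.fun_neg, deriv_comp_const_sub', neg_neg]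
  have := h.ae_eq_flux hL hA hR (hf.isTest ht)
  rw [e] at this
  exact this

/-- Time averages of weak solutions solve the sidewise system classically. -/
lemma IsWeakWave.isSidewiseSystem (hL : 0 < L) (h : IsWeakWave L T ρ a D W)
    (hA : ∀ f : H L, (A f : ℝ → ℝ) =ᵐ[volume.restrict (Ioo 0 L)] fun x => a x * f x)
    (hR : ∀ f : H L, (R f : ℝ → ℝ) =ᵐ[volume.restrict (Ioo 0 L)] fun x => ρ x * f x)
    (ha : ∀ x, 0 < a x) {ε t₀ t₁ : ℝ} {f : ℝ → ℝ} (hf : IsKernel ε f)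
    (ht₀ : ε < t₀) (ht₁ : t₁ < T - ε) :
    IsSidewiseSystem L t₀ t₁ ρ (fun x => (a x)⁻¹)
      (fun x t => ⟪chi L x, timeAvg (deriv f) D t⟫)
      (fun x t => flux L A R x (timeAvg f D t) (timeAvg (deriv (deriv f)) D t))
      (fun x t => ⟪chi L x, timeAvg (deriv (deriv f)) D t⟫)
      (fun x t => flux L A R x (timeAvg (deriv f) D t) (timeAvg (deriv (deriv (deriv f))) D t)) := by
  have hf1 := hf.deriv
  have hf2 := hf1.deriv
  have hf3 := hf2.deriv
  have cont : ∀ {g : ℝ → ℝ}, IsKernel ε g → Continuous (timeAvg g D) :=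
    fun hg => continuous_timeAvg hg.smooth hg.compact h.contD
  have der : ∀ {g : ℝ → ℝ}, IsKernel ε g → ∀ t, HasDerivAt (timeAvg g D) (timeAvg (deriv g) D t) t :=
    fun hg t => hasDerivAt_timeAvg hg.smooth hg.compact h.contD t
  have cinner : ∀ {g : ℝ → ℝ}, IsKernel ε g →
      Continuous (Function.uncurry fun x t => ⟪chi L x, timeAvg g D t⟫) := fun hg =>
    ((continuous_chi L).comp continuous_fst).inner ((cont hg).comp continuous_snd)
  refine ⟨cinner hf1, continuous_flux L A R (cont hf) (cont hf2), cinner hf2,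
    continuous_flux L A R (cont hf1) (cont hf3), ?_, ?_, ?_, ?_⟩
  · exact fun x _ t _ => hasDerivAt_inner_const _ (der hf1 t)
  · exact fun x _ t _ => hasDerivAt_flux L A R x (der hf t) (der hf2 t)
  · intro t ht
    have ht' : t ∈ Ioo ε (T - ε) := ⟨ht₀.trans_le ht.1, ht.2.trans_lt ht₁⟩
    refine (isPrimitive_inner_chi hL.le (timeAvg (deriv f) D t)).congr ?_ hL.le
    -- The flux identity for the kernel `f'` instead of `f` says `P_t = a V_x`.
    have e1 := h.timeAvg_ae_eq_flux hL hA hR hf1 ht'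
    have e2 := hA (timeAvg (deriv f) D t)
    rw [← ae_restrict_iff' measurableSet_Ioc, ← restrict_Ioo_eq_restrict_Ioc]
    filter_upwards [e1, e2] with x h1 h2
    rw [← h1, h2, inv_mul_cancel_left₀ (ha x).ne']
  · intro t ht
    have hp := isPrimitive_inner_chi hL.le (R (primitiveCLM L (timeAvg (deriv (deriv f)) D t)))
    refine IsPrimitive.congr (f' := R (primitiveCLM L (timeAvg (deriv (deriv f)) D t)))
      ⟨hp.integrable, fun x hx => ?_⟩ ?_ hL.le
    · have := hp.eq x hx
      simp only [flux]
      linarith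
    · rw [← ae_restrict_iff' measurableSet_Ioc, ← restrict_Ioo_eq_restrict_Ioc]
      filter_upwards [hR (primitiveCLM L (timeAvg (deriv (deriv f)) D t)),
        primitiveCLM_coeFn (timeAvg (deriv (deriv f)) D t)] with x h1 h2
      rw [h1, h2]

/-- The averaged velocity is an average of `W` against `f` itself. Its `L²` norm is therefore
bounded independently of the kernel, although `f'` blows up as the kernel concentrates. -/
lemma IsWeakWave.primitive_timeAvg_deriv (h : IsWeakWave L T ρ a D W) {ε t : ℝ} {f : ℝ → ℝ}
    (hf : IsKernel ε f) (ht : t ∈ Ioo ε (T - ε)) :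
    primitiveCLM L (timeAvg (deriv f) D t) = timeAvg f W t := by
  have := h.integral_deriv_deriv (hf.isTest ht)
  rw [deriv_comp_const_sub'] at this
  simp only [neg_smul, integral_neg, map_neg, neg_inj] at this
  exact this

lemma norm_timeAvg_le {ε t S : ℝ} {f : ℝ → ℝ} (hf : IsKernel ε f) (hf0 : ∀ σ, 0 ≤ f σ)
    (hf1 : ∫ σ, f σ = 1) (hD : ∀ τ ∈ Icc (t - ε) (t + ε), ‖D τ‖ ≤ S) :
    ‖timeAvg f D t‖ ≤ S := by
  have hint : Integrable f := hf.smooth.continuous.integrable_of_hasCompactSupport hf.compact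
  have hint' : Integrable fun τ => S * f (t - τ) := (hint.comp_sub_left t).const_mul S
  have : ∫ τ, S * f (t - τ) = S := by
    rw [integral_const_mul, integral_sub_left_eq_self (fun τ => f τ), hf1, mul_one]
  rw [timeAvg, ← this]
  refine norm_integral_le_of_norm_le hint' (ae_of_all _ fun τ => ?_)
  rw [norm_smul, Real.norm_of_nonneg (hf0 _), mul_comm]
  by_cases hτ : t - τ ∈ Icc (-ε) ε
  · exact mul_le_mul_of_nonneg_right (hD τ ⟨by linarith [hτ.2], by linarith [hτ.1]⟩) (hf0 _)
  · rw [hf.eq_zero hτ]; simp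

lemma integral_sq_eq_norm_sq (hL : 0 ≤ L) (e : H L) {F : ℝ → ℝ}
    (hF : (e : ℝ → ℝ) =ᵐ[volume.restrict (Ioo 0 L)] F) :
    ∫ x in (0 : ℝ)..L, F x ^ 2 = ‖e‖ ^ 2 := by
  rw [← real_inner_self_eq_norm_sq, L2.inner_def, ← integral_Ioo_eq hL]
  refine integral_congr_ae ?_
  filter_upwards [hF] with x hx
  rw [hx]
  simp [sq]

lemma IsWeakWave.integral_velocity_sq_le {ε t S : ℝ} (hL : 0 < L) (h : IsWeakWave L T ρ a D W)
    {f : ℝ → ℝ} (hf : IsKernel ε f) (hf0 : ∀ σ, 0 ≤ f σ) (hf1 : ∫ σ, f σ = 1)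
    (ht : t ∈ Ioo ε (T - ε)) (hS : ∀ τ ∈ Icc (t - ε) (t + ε), ‖W τ‖ ≤ S) :
    ∫ x in (0 : ℝ)..L, ⟪chi L x, timeAvg (deriv f) D t⟫ ^ 2 ≤ S ^ 2 := by
  rw [integral_sq_eq_norm_sq hL.le _ (primitiveCLM_coeFn (timeAvg (deriv f) D t)),
    h.primitive_timeAvg_deriv hf ht]
  exact pow_le_pow_left₀ (norm_nonneg _) (norm_timeAvg_le hf hf0 hf1 hS) 2

lemma IsWeakWave.integral_flux_sq_le {ε t a₁ S : ℝ} (hL : 0 < L) (h : IsWeakWave L T ρ a D W)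
    (hA : ∀ f : H L, (A f : ℝ → ℝ) =ᵐ[volume.restrict (Ioo 0 L)] fun x => a x * f x)
    (hAn : ∀ f : H L, ‖A f‖ ≤ a₁ * ‖f‖)
    (hR : ∀ f : H L, (R f : ℝ → ℝ) =ᵐ[volume.restrict (Ioo 0 L)] fun x => ρ x * f x)
    (ha₁ : 0 ≤ a₁) {f : ℝ → ℝ} (hf : IsKernel ε f) (hf0 : ∀ σ, 0 ≤ f σ) (hf1 : ∫ σ, f σ = 1)
    (ht : t ∈ Ioo ε (T - ε)) (hS : ∀ τ ∈ Icc (t - ε) (t + ε), ‖D τ‖ ≤ S) :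
    ∫ x in (0 : ℝ)..L, flux L A R x (timeAvg f D t) (timeAvg (deriv (deriv f)) D t) ^ 2 ≤
      a₁ ^ 2 * S ^ 2 := by
  rw [integral_sq_eq_norm_sq hL.le _ (h.timeAvg_ae_eq_flux hL hA hR hf ht), ← mul_pow]
  exact pow_le_pow_left₀ (norm_nonneg _) ((hAn _).trans
    (mul_le_mul_of_nonneg_left (norm_timeAvg_le hf hf0 hf1 hS) ha₁)) 2

/-! ### Boundary terms of the sidewise energy. -/

/-- The lateral derivative controls the flux at the boundary. -/
lemma abs_flux_zero_le {a₁ G : ℝ} (hL : 0 < L)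
    (hA : ∀ f : H L, (A f : ℝ → ℝ) =ᵐ[volume.restrict (Ioo 0 L)] fun x => a x * f x)
    (ha : ∀ x, 0 < a x) (ha₁ : ∀ x, a x ≤ a₁) {e₀ e₂ : H L}
    (he : (A e₀ : ℝ → ℝ) =ᵐ[volume.restrict (Ioo 0 L)] fun x => flux L A R x e₀ e₂)
    (hG : Tendsto (fun h => ⟪chi L h, e₀⟫ / h) (𝓝[>] 0) (𝓝 G)) :
    |flux L A R 0 e₀ e₂| ≤ a₁ * |G| := by
  have ha₁' : 0 < a₁ := (ha 0).trans_le (ha₁ 0)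
  set p : ℝ → ℝ := fun x => flux L A R x e₀ e₂ with hp
  have pc : Continuous p :=
    (continuous_flux L A R (e₀ := fun _ => e₀) (e₂ := fun _ => e₂) continuous_const
      continuous_const).comp (Continuous.prodMk_left (0 : ℝ))
  have hae : (e₀ : ℝ → ℝ) =ᵐ[volume.restrict (Ioo 0 L)] fun x => (a x)⁻¹ * p x := by
    filter_upwards [he, hA e₀] with x h1 h2
    rw [← h1, h2, inv_mul_cancel_left₀ (ha x).ne']
  -- The sign `s` reduces to a positive continuous flux `q`. If `q > m'` near `0`, then `s e₀ = q/a
  -- ≥ m'/a₁` there, and so is its mean over `(0,h)`; no trace of `a` at `0` is needed.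
  have key : ∀ {q : ℝ → ℝ} {s : ℝ}, |s| = 1 → (∀ x, q x = s * p x) → 0 < q 0 → q 0 ≤ a₁ * |G| := by
    intro q s hs hq hq0
    have qc : Continuous q := by rw [funext hq]; fun_prop
    refine le_of_forall_lt fun m hm => ?_
    obtain ⟨m', hm', hm'0⟩ := exists_between (max_lt hm hq0)
    have m'0 : 0 < m' := (le_max_right _ _).trans_lt hm'
    have ev : ∀ᶠ x in 𝓝 (0 : ℝ), m' < q x := qc.continuousAt.eventually (lt_mem_nhds hm'0)
    obtain ⟨r, hr, hrq⟩ := Metric.eventually_nhds_iff.1 ev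
    have ev2 : ∀ᶠ h in 𝓝[>] (0 : ℝ), m' / a₁ ≤ |⟪chi L h, e₀⟫ / h| := by
      filter_upwards [Ioo_mem_nhdsGT (lt_min hr hL)] with h hh
      have hhL : h < L := hh.2.trans_le (min_le_right _ _)
      have hhr : h < r := hh.2.trans_le (min_le_left _ _)
      have hmem : h ∈ Icc 0 L := ⟨hh.1.le, hhL.le⟩
      have h0mem : (0 : ℝ) ∈ Icc 0 L := ⟨le_rfl, hL.le⟩
      rw [inner_chi hmem, abs_div, abs_of_pos hh.1, le_div_iff₀ hh.1]
      have hip := isPrimitive_inner_chi hL.le e₀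
      have e1 : ∫ y in (0 : ℝ)..h, m' / a₁ ≤ ∫ y in (0 : ℝ)..h, s * e₀ y := by
        refine intervalIntegral.integral_mono_ae_restrict hh.1.le (by simp)
          ((hip.intervalIntegrable h0mem hmem).const_mul s) ?_
        rw [← restrict_Ioo_eq_restrict_Icc]
        have := ae_restrict_of_ae_restrict_of_subset (Ioo_subset_Ioo_right hhL.le) hae
        filter_upwards [this, ae_restrict_mem measurableSet_Ioo] with y hy hym
        rw [hy, mul_left_comm, ← hq, div_eq_inv_mul]
        have : m' < q y := hrq (by rw [Real.dist_eq, sub_zero, abs_of_pos hym.1]; exact hym.2.trans hhr)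
        exact mul_le_mul (inv_anti₀ (ha y) (ha₁ y)) this.le m'0.le (inv_nonneg.2 (ha y).le)
      rw [intervalIntegral.integral_const, intervalIntegral.integral_const_mul, sub_zero,
        smul_eq_mul, mul_comm] at e1
      refine e1.trans ((le_abs_self _).trans ?_)
      rw [abs_mul, hs, one_mul]
    have := ge_of_tendsto hG.abs ev2
    rw [div_le_iff₀ ha₁'] at this
    calc m < m' := (le_max_left _ _).trans_lt hm'
      _ ≤ a₁ * |G| := by linarith
  rcases lt_trichotomy (p 0) 0 with h0 | h0 | h0
  · have := key (q := fun x => -p x) (s := -1) (by simp) (fun x => by ring) (by simpa using h0)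
    rwa [← abs_of_neg h0] at this
  · change |p 0| ≤ _
    rw [h0, abs_zero]; positivity
  · have := key (q := p) (s := 1) (by simp) (fun x => by ring) h0
    rwa [← abs_of_pos h0] at this

/-- The sidewise energy estimate with boundary data `V(0,·) = 0`, `|P(0,·)| ≤ a₁ |G|`. -/
lemma IsSidewiseSystem.energy_le_boundary {L t₀ t₁ β K a₁ S : ℝ} (hL : 0 < L) (ht : t₀ ≤ t₁)
    (hβ : 0 ≤ β) {ρ α r q θ w w' : ℝ → ℝ} {V P Vt Pt : ℝ → ℝ → ℝ}
    (hs : IsSidewiseSystem L t₀ t₁ ρ α V P Vt Pt)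
    (hr : Antitone r) (hq : Antitone q) (hqL : 0 ≤ q L) (hρm : Measurable ρ) (hαm : Measurable α)
    (hρK : ∀ x, |ρ x| ≤ K) (hαK : ∀ x, |α x| ≤ K)
    (hcoef : ∀ᵐ x, x ∈ Ioc 0 L → 0 ≤ θ x ∧ 0 ≤ ρ x ∧ 0 ≤ α x ∧ ρ x * α x ≤ β ^ 2 ∧
      r x = θ x * ρ x ∧ q x = θ x * α x ∧ θ x * ρ x * α x ≤ K)
    (hw : ∀ σ, HasDerivAt w (w' σ) σ) (hw' : Continuous w')
    (hw0 : ∀ σ, 0 ≤ w σ) (hw1 : ∀ σ, w σ ≤ 1) (hw'0 : ∀ σ, 0 ≤ w' σ) (hwt : ∀ σ ≤ t₀, w σ = 0)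
    {G : ℝ → ℝ} (hGi : IntervalIntegrable (fun t => G t ^ 2) volume t₀ t₁)
    (hV0 : ∀ t, V 0 t = 0) (hP0 : ∀ t ∈ Icc t₀ t₁, |P 0 t| ≤ a₁ * |G t|)
    (hVS : ∫ x in (0 : ℝ)..L, V x t₁ ^ 2 ≤ S ^ 2)
    (hPS : ∫ x in (0 : ℝ)..L, P x t₁ ^ 2 ≤ a₁ ^ 2 * S ^ 2) :
    r L * (∫ t in t₀..t₁, w (t - β * L) * V L t ^ 2) ≤
      q 0 * a₁ ^ 2 * (∫ t in t₀..t₁, G t ^ 2) + K * (1 + a₁ ^ 2) * S ^ 2 := by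
  have E := hs.energy_le hL.le ht hβ hr hq hρm hαm hρK hαK hcoef hw hw' hw0 hw1 hw'0 hwt
  have hK : 0 ≤ K := (abs_nonneg _).trans (hρK 0)
  have hq0 : 0 ≤ q 0 := hqL.trans (hq hL.le)
  have hwc : Continuous w := continuous_iff_continuousAt.2 fun σ => (hw σ).continuousAt
  have z1 : 0 ≤ q L * ∫ t in t₀..t₁, w (t - β * L) * P L t ^ 2 :=
    mul_nonneg hqL (intervalIntegral.integral_nonneg ht fun t _ =>
      mul_nonneg (hw0 _) (sq_nonneg _))
  have z2 : ∫ t in t₀..t₁, w t * V 0 t ^ 2 = 0 := by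
    simp [hV0]
  have z3 : ∫ t in t₀..t₁, w t * P 0 t ^ 2 ≤ a₁ ^ 2 * ∫ t in t₀..t₁, G t ^ 2 := by
    rw [← intervalIntegral.integral_const_mul]
    refine intervalIntegral.integral_mono_on ht ?_ (hGi.const_mul _) fun t htt => ?_
    · refine Continuous.intervalIntegrable ?_ _ _
      have : Continuous (P 0) := hs.contP.comp (Continuous.prodMk_right 0)
      fun_prop
    · have b2 : P 0 t ^ 2 ≤ a₁ ^ 2 * G t ^ 2 := by
        rw [← sq_abs, ← sq_abs (G t), ← mul_pow]
        exact pow_le_pow_left₀ (abs_nonneg _) (hP0 t htt) 2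
      exact (mul_le_of_le_one_left (sq_nonneg _) (hw1 _)).trans b2
  have cV : Continuous fun x => V x t₁ := hs.contV.comp (Continuous.prodMk_left t₁)
  have cP : Continuous fun x => P x t₁ := hs.contP.comp (Continuous.prodMk_left t₁)
  -- Young's inequality `2|VP| ≤ V² + P²`, then the two bounds at time `t₁`.
  have z4 : ∫ x in (0 : ℝ)..L, 2 * K * |V x t₁ * P x t₁| ≤ K * (1 + a₁ ^ 2) * S ^ 2 := by
    have : ∫ x in (0 : ℝ)..L, 2 * K * |V x t₁ * P x t₁| ≤
        ∫ x in (0 : ℝ)..L, K * (V x t₁ ^ 2 + P x t₁ ^ 2) := by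
      refine intervalIntegral.integral_mono_on hL.le
        (Continuous.intervalIntegrable (by fun_prop) _ _)
        (Continuous.intervalIntegrable (by fun_prop) _ _) fun x _ => ?_
      rw [mul_comm 2 K, mul_assoc, abs_mul]
      refine mul_le_mul_of_nonneg_left ?_ hK
      have := two_mul_le_add_sq |V x t₁| |P x t₁|
      rw [sq_abs, sq_abs] at this
      linarith
    refine this.trans ?_
    have i1 : IntervalIntegrable (fun x => V x t₁ ^ 2) volume 0 L :=
      (cV.pow 2).intervalIntegrable _ _
    have i2 : IntervalIntegrable (fun x => P x t₁ ^ 2) volume 0 L :=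
      (cP.pow 2).intervalIntegrable _ _
    rw [intervalIntegral.integral_const_mul, intervalIntegral.integral_add i1 i2]
    rw [mul_assoc]
    exact mul_le_mul_of_nonneg_left (by linarith) hK
  rw [z2, mul_zero, zero_add] at E
  have z5 := mul_le_mul_of_nonneg_left z3 hq0
  rw [← mul_assoc] at z5
  linarith

/-- The sidewise energy estimate for the time averages of a weak solution. -/
lemma IsWeakWave.timeAvg_energy_le {ε t₀ t₁ β K a₁ S : ℝ} (hL : 0 < L)
    (h : IsWeakWave L T ρ a D W)
    (hA : ∀ f : H L, (A f : ℝ → ℝ) =ᵐ[volume.restrict (Ioo 0 L)] fun x => a x * f x)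
    (hAn : ∀ f : H L, ‖A f‖ ≤ a₁ * ‖f‖)
    (hR : ∀ f : H L, (R f : ℝ → ℝ) =ᵐ[volume.restrict (Ioo 0 L)] fun x => ρ x * f x)
    (ha : ∀ x, 0 < a x) (ha₁ : ∀ x, a x ≤ a₁) (hβ : 0 ≤ β)
    {r q θ w w' : ℝ → ℝ} (hr : Antitone r) (hq : Antitone q) (hqL : 0 ≤ q L)
    (hρm : Measurable ρ) (ham : Measurable a)
    (hρK : ∀ x, |ρ x| ≤ K) (hαK : ∀ x, |(a x)⁻¹| ≤ K)
    (hcoef : ∀ᵐ x, x ∈ Ioc 0 L → 0 ≤ θ x ∧ 0 ≤ ρ x ∧ 0 ≤ (a x)⁻¹ ∧ ρ x * (a x)⁻¹ ≤ β ^ 2 ∧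
      r x = θ x * ρ x ∧ q x = θ x * (a x)⁻¹ ∧ θ x * ρ x * (a x)⁻¹ ≤ K)
    (hw : ∀ σ, HasDerivAt w (w' σ) σ) (hw' : Continuous w')
    (hw0 : ∀ σ, 0 ≤ w σ) (hw1 : ∀ σ, w σ ≤ 1) (hw'0 : ∀ σ, 0 ≤ w' σ) (hwt : ∀ σ ≤ t₀, w σ = 0)
    {f : ℝ → ℝ} (hf : IsKernel ε f) (hf0 : ∀ σ, 0 ≤ f σ) (hf1 : ∫ σ, f σ = 1)
    (ht₀ : ε < t₀) (ht : t₀ ≤ t₁) (ht₁ : t₁ < T - ε)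
    (hS : ∀ τ ∈ Icc (t₁ - ε) (t₁ + ε), ‖D τ‖ ≤ S ∧ ‖W τ‖ ≤ S)
    {G : ℝ → ℝ} (hGi : IntervalIntegrable (fun t => G t ^ 2) volume t₀ t₁)
    (hG : ∀ t ∈ Icc t₀ t₁,
      Tendsto (fun h => ⟪chi L h, timeAvg f D t⟫ / h) (𝓝[>] 0) (𝓝 (G t))) :
    r L * (∫ t in t₀..t₁, w (t - β * L) * ⟪chi L L, timeAvg (deriv f) D t⟫ ^ 2) ≤
      q 0 * a₁ ^ 2 * (∫ t in t₀..t₁, G t ^ 2) + K * (1 + a₁ ^ 2) * S ^ 2 := by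
  have hsys := h.isSidewiseSystem hL hA hR ha hf ht₀ ht₁
  have hmem : ∀ t ∈ Icc t₀ t₁, t ∈ Ioo ε (T - ε) := fun t h' =>
    ⟨ht₀.trans_le h'.1, h'.2.trans_lt ht₁⟩
  have ht1 : t₁ ∈ Ioo ε (T - ε) := hmem t₁ ⟨ht, le_rfl⟩
  exact hsys.energy_le_boundary hL ht hβ hr hq hqL hρm ham.inv hρK hαK hcoef hw hw' hw0 hw1 hw'0
    hwt hGi (fun t => by rw [chi_zero, inner_zero_left])
    (fun t htt => abs_flux_zero_le hL hA ha ha₁ (h.timeAvg_ae_eq_flux hL hA hR hf (hmem t htt))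
      (hG t htt))
    (h.integral_velocity_sq_le hL hf hf0 hf1 ht1 fun τ hτ => (hS τ hτ).2)
    (h.integral_flux_sq_le hL hA hAn hR ((ha 0).le.trans (ha₁ 0)) hf hf0 hf1 ht1
      fun τ hτ => (hS τ hτ).1)

end WeakWave

/-! ### From finite-energy solutions to curves in `L²(0,L)`. -/

open Classical in
/-- The class of `u` in `L²(0,L)`, and `0` if `u` is not square integrable. -/
def toH (L : ℝ) (u : ℝ → ℝ) : H L :=
  if h : MemL2 0 L u then h.toLp u else 0

lemma toH_coeFn {L : ℝ} {u : ℝ → ℝ} (h : MemL2 0 L u) :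
    (toH L u : ℝ → ℝ) =ᵐ[volume.restrict (Ioo 0 L)] u := by
  rw [toH, dif_pos h]
  exact h.coeFn_toLp

lemma norm_eq_l2Norm {L : ℝ} (hL : 0 ≤ L) (e : H L) {u : ℝ → ℝ}
    (h : (e : ℝ → ℝ) =ᵐ[volume.restrict (Ioo 0 L)] u) : ‖e‖ = l2Norm 0 L u := by
  rw [l2Norm, integral_sq_eq_norm_sq hL e h, Real.sqrt_sq (norm_nonneg _)]

lemma norm_toH_sub_toH {L : ℝ} (hL : 0 ≤ L) {u v w : ℝ → ℝ} (hu : MemL2 0 L u) (hv : MemL2 0 L v)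
    (hw : (fun x => u x - v x) =ᵐ[volume.restrict (Ioo 0 L)] w) :
    ‖toH L u - toH L v‖ = l2Norm 0 L w := by
  refine norm_eq_l2Norm hL _ ?_
  filter_upwards [Lp.coeFn_sub (toH L u) (toH L v), toH_coeFn hu, toH_coeFn hv, hw]
    with x h1 h2 h3 h4
  rw [h1, Pi.sub_apply, h2, h3, h4]

lemma l2Norm_deriv_le_h1Norm {c d : ℝ} (hcd : c ≤ d) (u : ℝ → ℝ) :
    l2Norm c d (deriv u) ≤ h1Norm c d u :=
  Real.sqrt_le_sqrt (le_add_of_nonneg_left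
    (intervalIntegral.integral_nonneg hcd fun _ _ => sq_nonneg _))

lemma MemH1.ae_deriv_sub {L : ℝ} (hL : 0 ≤ L) {u v : ℝ → ℝ} (hu : MemH1 0 L u) (hv : MemH1 0 L v) :
    (fun x => deriv u x - deriv v x) =ᵐ[volume.restrict (Ioo 0 L)]
      deriv fun x => u x - v x := by
  refine (ae_restrict_iff' measurableSet_Ioo).2 ?_
  filter_upwards [hu.1.ae_differentiableAt, hv.1.ae_differentiableAt] with x h1 h2 hx
  have hx' : x ∈ uIcc 0 L := by rw [uIcc_of_le hL]; exact Ioo_subset_Icc_self hx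
  exact (deriv_fun_sub (h1 hx') (h2 hx')).symm

lemma MemH1.inner_chi {L : ℝ} {u : ℝ → ℝ} (hu : MemH1 0 L u) {e : H L}
    (he : (e : ℝ → ℝ) =ᵐ[volume.restrict (Ioo 0 L)] deriv u) {x : ℝ} (hx : x ∈ Icc 0 L) :
    ⟪chi L x, e⟫ = u x - u 0 := by
  rw [SidewiseWave.inner_chi hx, ← (hu.1.mono (c := 0) (d := x) _).integral_deriv_eq_sub]
  · rw [intervalIntegral.integral_of_le hx.1, intervalIntegral.integral_of_le hx.1,
      ← restrict_Ioo_eq_restrict_Ioc]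
    exact integral_congr_ae (ae_restrict_of_ae_restrict_of_subset (Ioo_subset_Ioo_right hx.2) he)
  · rw [uIcc_of_le hx.1, uIcc_of_le (hx.1.trans hx.2)]
    exact Icc_subset_Icc_right hx.2

lemma continuous_comp_projIcc {T : ℝ} (hT : 0 ≤ T) {E : Type*} [NormedAddCommGroup E] {d : ℝ → E}
    (h : ∀ t ∈ Icc 0 T, Tendsto (fun τ => ‖d τ - d t‖) (𝓝[Icc 0 T] t) (𝓝 0)) :
    Continuous fun τ => d (projIcc 0 T hT τ) := by
  have : ContinuousOn d (Icc 0 T) := fun t ht => tendsto_iff_norm_sub_tendsto_zero.2 (h t ht)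
  exact (continuousOn_iff_continuous_domRestrict.1 this).comp continuous_projIcc

lemma isTestFunction_mul {L T : ℝ} {ξ η : ℝ → ℝ} (hξ : IsTest L ξ) (hη : IsTest T η) :
    IsTestFunction L T fun x t => ξ x * η t := by
  have hsub : Function.support (Function.uncurry fun x t => ξ x * η t) ⊆
      tsupport ξ ×ˢ tsupport η := fun p hp =>
    ⟨subset_tsupport _ (left_ne_zero_of_mul hp), subset_tsupport _ (right_ne_zero_of_mul hp)⟩
  refine ⟨?_, ?_, ?_⟩
  · exact (hξ.smooth.comp contDiff_fst).mul (hη.smooth.comp contDiff_snd)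
  · exact HasCompactSupport.of_support_subset_isCompact (hξ.compact.isCompact.prod
      hη.compact.isCompact) hsub
  · exact (closure_minimal hsub ((isClosed_tsupport ξ).prod (isClosed_tsupport η))).trans
      (prod_mono hξ.tsupport_subset hη.tsupport_subset)

/-- A finite-energy solution as a weak solution in terms of curves in `L²(0,L)`. -/
lemma IsFiniteEnergySolution.exists_isWeakWave {L T K : ℝ} (hL : 0 < L) (hT : 0 < T)
    {ρ a ρ' a' s g : ℝ → ℝ} {ψ ψt : ℝ → ℝ → ℝ} (h : IsFiniteEnergySolution L T ρ a s ψ ψt g)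
    (hρ : ρ =ᵐ[volume.restrict (Ioo 0 L)] ρ') (ha : a =ᵐ[volume.restrict (Ioo 0 L)] a')
    (hρm : Measurable ρ') (ham : Measurable a') (hρK : ∀ x, |ρ' x| ≤ K) (haK : ∀ x, |a' x| ≤ K) :
    ∃ D W : ℝ → H L, IsWeakWave L T ρ' a' D W ∧
      (∀ τ ∈ Ioo 0 T, ∀ x ∈ Icc 0 L, ⟪chi L x, D τ⟫ = ψ x τ) ∧ D T = 0 ∧ W T = 0 := by
  -- Constant extension in time outside `[0,T]` makes both curves continuous on the line; the test
  -- functions only see `(0,T)`.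
  set p : ℝ → ℝ := fun τ => projIcc 0 T hT.le τ with hp
  have pmem : ∀ τ, p τ ∈ Icc 0 T := fun τ => (projIcc 0 T hT.le τ).2
  have pid : ∀ τ ∈ Icc 0 T, p τ = τ := fun τ hτ => by
    simp only [hp]; rw [projIcc_of_mem hT.le hτ]
  set D : ℝ → H L := fun τ => toH L (deriv fun x => ψ x (p τ)) with hD
  set W : ℝ → H L := fun τ => toH L fun x => ψt x (p τ) with hW
  have Dae : ∀ τ, (D τ : ℝ → ℝ) =ᵐ[volume.restrict (Ioo 0 L)] deriv fun x => ψ x (p τ) :=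
    fun τ => toH_coeFn (h.memH1 _ (pmem τ)).2
  have Wae : ∀ τ, (W τ : ℝ → ℝ) =ᵐ[volume.restrict (Ioo 0 L)] fun x => ψt x (p τ) :=
    fun τ => toH_coeFn (h.memL2 _ (pmem τ))
  have Dchi : ∀ τ ∈ Ioo 0 T, ∀ x ∈ Icc 0 L, ⟪chi L x, D τ⟫ = ψ x τ := by
    intro τ hτ x hx
    rw [(h.memH1 _ (pmem τ)).inner_chi (Dae τ) hx, pid τ (Ioo_subset_Icc_self hτ), h.left τ hτ,
      sub_zero]
  have Dcont : Continuous D := by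
    refine continuous_comp_projIcc (d := fun τ => toH L (deriv fun x => ψ x τ)) hT.le fun t ht => ?_
    refine squeeze_zero' (Eventually.of_forall fun _ => norm_nonneg _) ?_ (h.contH1 t ht)
    filter_upwards [self_mem_nhdsWithin] with τ hτ
    rw [norm_toH_sub_toH hL.le (h.memH1 τ hτ).2 (h.memH1 t ht).2
      ((h.memH1 τ hτ).ae_deriv_sub hL.le (h.memH1 t ht))]
    exact l2Norm_deriv_le_h1Norm hL.le _
  have Wcont : Continuous W := by
    refine continuous_comp_projIcc (d := fun τ => toH L fun x => ψt x τ) hT.le fun t ht => ?_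
    refine (h.contL2 t ht).congr' ?_
    filter_upwards [self_mem_nhdsWithin] with τ hτ
    rw [norm_toH_sub_toH hL.le (h.memL2 τ hτ) (h.memL2 t ht) (ae_eq_refl _)]
  have Jae : ∀ τ ∈ Ioo 0 T,
      (primitiveCLM L (D τ) : ℝ → ℝ) =ᵐ[volume.restrict (Ioo 0 L)] fun x => ψ x τ := by
    intro τ hτ
    filter_upwards [primitiveCLM_coeFn (D τ), ae_restrict_mem measurableSet_Ioo] with x h1 h2
    rw [h1, Dchi τ hτ x (Ioo_subset_Icc_self h2)]
  refine ⟨D, W, ⟨Dcont, Wcont, ?_, ?_⟩, Dchi, ?_, ?_⟩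
  · intro t ht
    have ht' := Ioo_subset_Icc_self ht
    -- The norm of the slope minus `W t` is exactly the `l2Norm` in `hasTimeDeriv`.
    rw [hasDerivAt_iff_tendsto_slope, tendsto_iff_norm_sub_tendsto_zero]
    have hnhds : 𝓝[Icc 0 T \ {t}] t = 𝓝[≠] t := by
      rw [sdiff_eq, nhdsWithin_inter_of_mem (mem_nhdsWithin_of_mem_nhds (Icc_mem_nhds ht.1 ht.2))]
    have hd := h.hasTimeDeriv t ht'
    rw [hnhds] at hd
    refine hd.congr' ?_
    filter_upwards [mem_nhdsWithin_of_mem_nhds (Ioo_mem_nhds ht.1 ht.2)] with τ hτ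
    refine (norm_eq_l2Norm hL.le _ ?_).symm
    rw [slope_def_module]
    filter_upwards [Lp.coeFn_sub ((τ - t)⁻¹ • (primitiveCLM L (D τ) - primitiveCLM L (D t))) (W t),
      Lp.coeFn_smul (τ - t)⁻¹ (primitiveCLM L (D τ) - primitiveCLM L (D t)),
      Lp.coeFn_sub (primitiveCLM L (D τ)) (primitiveCLM L (D t)), Jae τ hτ, Jae t ht, Wae t]
      with x e1 e2 e3 e4 e5 e6
    rw [e1, Pi.sub_apply, e2, Pi.smul_apply, e3, Pi.sub_apply, e4, e5, e6, pid t ht', smul_eq_mul,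
      div_eq_inv_mul]
  · intro ξ η hξ hη
    have key := h.equation _ (isTestFunction_mul hξ hη)
    refine Eq.trans ?_ key
    rw [intervalIntegral.integral_of_le hT.le, ← restrict_Ioo_eq_restrict_Ioc]
    rw [← setIntegral_eq_integral_of_forall_compl_eq_zero (s := Ioo 0 T)]
    · refine setIntegral_congr_fun measurableSet_Ioo fun t ht => ?_
      have e1 : ∀ x, deriv (fun τ => ξ x * η τ) t = ξ x * deriv η t := fun x =>
        ((hη.hasDerivAt t).const_mul (ξ x)).deriv
      have e2 : ∀ x, deriv (fun y => ξ y * η t) x = deriv ξ x * η t := fun x =>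
        ((hξ.hasDerivAt x).mul_const (η t)).deriv
      simp only [e1, e2]
      symm
      have i1 : Integrable (fun x => ρ' x * W t x * ξ x) (volume.restrict (Ioo 0 L)) :=
        (memLp_mul hρm hρK (Lp.memLp (W t))).integrable_mul hξ.memLp
      have i2 : Integrable (fun x => a' x * D t x * deriv ξ x) (volume.restrict (Ioo 0 L)) :=
        (memLp_mul ham haK (Lp.memLp (D t))).integrable_mul hξ.deriv.memLp
      rw [← integral_Ioo_eq hL.le, ← integral_Ioo_eq hL.le, ← integral_Ioo_eq hL.le,
        ← integral_const_mul, ← integral_const_mul, ← integral_neg, ← integral_add]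
      · refine integral_congr_ae ?_
        filter_upwards [hρ, ha, Wae t, Dae t] with x h1 h2 h3 h4
        rw [h1, h2, h3, h4, pid t (Ioo_subset_Icc_self ht)]
        ring
      · exact (i1.const_mul _).neg
      · exact i2.const_mul _
    · intro t ht
      rw [hη.eq_zero ht, hη.deriv.eq_zero ht]
      ring
  · have hTm : T ∈ Icc 0 T := ⟨hT.le, le_rfl⟩
    refine (Lp.eq_zero_iff_ae_eq_zero).2 ?_
    filter_upwards [Dae T, ae_restrict_mem measurableSet_Ioo] with x h1 h2
    rw [h1, pid T hTm]
    have : (fun x => ψ x T) =ᶠ[𝓝 x] fun _ => 0 := by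
      filter_upwards [Ioo_mem_nhds h2.1 h2.2] with y hy
      exact h.final y hy
    rw [this.deriv_eq]; simp
  · have hTm : T ∈ Icc 0 T := ⟨hT.le, le_rfl⟩
    refine (Lp.eq_zero_iff_ae_eq_zero).2 ?_
    filter_upwards [Wae T, h.final_deriv] with x h1 h2
    rw [h1, pid T hTm, h2]; rfl

/-! ### Mollification, Fatou's lemma, the cut-off and a Poincaré inequality. -/

/-- The weighted Cauchy–Schwarz inequality. -/
lemma sq_integral_mul_le {α : Type*} [MeasurableSpace α] {μ : Measure α} {f u : α → ℝ}
    (hf : ∀ x, 0 ≤ f x) (h0 : Integrable f μ) (h1 : Integrable (fun x => f x * u x) μ)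
    (h2 : Integrable (fun x => f x * u x ^ 2) μ) :
    (∫ x, f x * u x ∂μ) ^ 2 ≤ (∫ x, f x ∂μ) * ∫ x, f x * u x ^ 2 ∂μ := by
  -- The polynomial is `∫ f (u - l)² ≥ 0`, so its discriminant is nonpositive.
  have key : ∀ l : ℝ, 0 ≤ (∫ x, f x ∂μ) * (l * l) + (-2 * ∫ x, f x * u x ∂μ) * l
      + ∫ x, f x * u x ^ 2 ∂μ := by
    intro l
    have : 0 ≤ ∫ x, f x * (u x - l) ^ 2 ∂μ :=
      integral_nonneg fun x => mul_nonneg (hf x) (sq_nonneg _)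
    have e : ∫ x, f x * (u x - l) ^ 2 ∂μ =
        ∫ x, ((l * l) * f x + (-2 * l) * (f x * u x) + f x * u x ^ 2) ∂μ :=
      integral_congr_ae (ae_of_all _ fun x => by ring)
    have i : Integrable (fun x => (l * l) * f x + (-2 * l) * (f x * u x)) μ :=
      (h0.const_mul _).add (h1.const_mul _)
    rw [e, integral_add i h2, integral_add (h0.const_mul _) (h1.const_mul _), integral_const_mul,
      integral_const_mul] at this
    linarith
  have := discrim_le_zero key
  rw [discrim] at this
  linarith

lemma IsKernel.integrable {ε : ℝ} {f : ℝ → ℝ} (hf : IsKernel ε f) : Integrable f :=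
  hf.smooth.continuous.integrable_of_hasCompactSupport hf.compact

lemma IsKernel.integrable_mul {ε : ℝ} {f u : ℝ → ℝ} (hf : IsKernel ε f) (hu : Integrable u)
    (t : ℝ) : Integrable fun τ => f (t - τ) * u τ := by
  obtain ⟨C, hC⟩ := hf.compact.exists_bound_of_continuous hf.smooth.continuous
  refine hu.bdd_mul (c := C) ?_ (ae_of_all _ fun τ => hC _)
  exact (hf.smooth.continuous.comp (continuous_const.sub continuous_id)).aestronglyMeasurable

lemma IsKernel.convolution_eq {f : ℝ → ℝ} (u : ℝ → ℝ) (t : ℝ) :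
    convolution f u (ContinuousLinearMap.lsmul ℝ ℝ) volume t = ∫ τ, f (t - τ) * u τ := by
  rw [convolution_lsmul_swap]
  rfl

lemma IsKernel.continuous_integral_mul {ε : ℝ} {f u : ℝ → ℝ} (hf : IsKernel ε f)
    (hu : Integrable u) : Continuous fun t => ∫ τ, f (t - τ) * u τ := by
  have := hf.compact.continuous_convolution_left (μ := volume) (ContinuousLinearMap.lsmul ℝ ℝ)
    hf.smooth.continuous hu.locallyIntegrable
  rwa [funext (IsKernel.convolution_eq u)] at this

/-- Mollification does not increase the `L²` norm. -/
lemma IsKernel.integral_sq_le {ε : ℝ} {f u : ℝ → ℝ} (hf : IsKernel ε f) (hf0 : ∀ σ, 0 ≤ f σ)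
    (hf1 : ∫ σ, f σ = 1) (hu : Integrable u) (hu2 : Integrable fun τ => u τ ^ 2) {s e : ℝ}
    (hse : s ≤ e) : ∫ t in s..e, (∫ τ, f (t - τ) * u τ) ^ 2 ≤ ∫ τ, u τ ^ 2 := by
  -- Cauchy-Schwarz with respect to the probability density `f(t - ·)`; integrating in `t` then
  -- preserves the total mass of `u²`.
  have b : ∀ t, (∫ τ, f (t - τ) * u τ) ^ 2 ≤ ∫ τ, f (t - τ) * u τ ^ 2 := by
    intro t
    have := sq_integral_mul_le (μ := volume) (f := fun τ => f (t - τ)) (u := u) (fun τ => hf0 _)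
      (hf.integrable.comp_sub_left t) (hf.integrable_mul hu t) (hf.integrable_mul hu2 t)
    rwa [integral_sub_left_eq_self (fun τ => f τ), hf1, one_mul] at this
  have hci : Integrable fun t => ∫ τ, f (t - τ) * u τ ^ 2 := by
    have := hf.integrable.integrable_convolution (ContinuousLinearMap.lsmul ℝ ℝ) hu2
    rwa [funext (IsKernel.convolution_eq fun τ => u τ ^ 2)] at this
  have tot : ∫ t, ∫ τ, f (t - τ) * u τ ^ 2 = ∫ τ, u τ ^ 2 := by
    have := integral_convolution (ContinuousLinearMap.lsmul ℝ ℝ) hf.integrable hu2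
    rw [funext (IsKernel.convolution_eq fun τ => u τ ^ 2), hf1] at this
    simpa using this
  rw [← tot, intervalIntegral.integral_of_le hse]
  refine (integral_mono ?_ hci.integrableOn b).trans ?_
  · exact ((((hf.continuous_integral_mul hu).pow 2).intervalIntegrable s e).1)
  · exact setIntegral_le_integral hci (ae_of_all _ fun t =>
      integral_nonneg fun τ => mul_nonneg (hf0 _) (sq_nonneg _))

/-- Fatou's lemma for real-valued functions with bounded integrals. -/
lemma integral_le_of_tendsto_ae {α : Type*} [MeasurableSpace α] {μ : Measure α}
    {F : ℕ → α → ℝ} {u : α → ℝ} {B : ℝ} (hF : ∀ n, Integrable (F n) μ) (hF0 : ∀ n x, 0 ≤ F n x)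
    (hu : AEStronglyMeasurable u μ) (hlim : ∀ᵐ x ∂μ, Tendsto (fun n => F n x) atTop (𝓝 (u x)))
    (hB : ∀ᶠ n in atTop, ∫ x, F n x ∂μ ≤ B) : ∫ x, u x ∂μ ≤ B := by
  have hu0 : 0 ≤ᵐ[μ] u := by
    filter_upwards [hlim] with x hx
    exact ge_of_tendsto' hx fun n => hF0 n x
  have hB0 : 0 ≤ B := by
    obtain ⟨n, hn⟩ := hB.exists
    exact (integral_nonneg (hF0 n)).trans hn
  rw [integral_eq_lintegral_of_nonneg_ae hu0 hu]
  refine ENNReal.toReal_le_of_le_ofReal hB0 ?_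
  have e : ∫⁻ x, ENNReal.ofReal (u x) ∂μ =
      ∫⁻ x, liminf (fun n => ENNReal.ofReal (F n x)) atTop ∂μ := by
    refine lintegral_congr_ae ?_
    filter_upwards [hlim] with x hx
    exact ((ENNReal.continuous_ofReal.tendsto _).comp hx).liminf_eq.symm
  rw [e]
  refine (lintegral_liminf_le' fun n => (hF n).1.aemeasurable.ennreal_ofReal).trans ?_
  refine liminf_le_of_le (by isBoundedDefault) fun b hb => ?_
  obtain ⟨n, h1, h2⟩ := (hb.and hB).exists
  refine h1.trans ?_
  rw [← ofReal_integral_eq_lintegral_ofReal (hF n) (ae_of_all _ (hF0 n))]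
  exact ENNReal.ofReal_le_ofReal h2

/-- The smooth cut-off `0` on `(-∞,δ]` and `1` on `[2δ,∞)`. -/
lemma exists_cutoff {δ : ℝ} (hδ : 0 < δ) :
    ∃ w w' : ℝ → ℝ, (∀ σ, HasDerivAt w (w' σ) σ) ∧ Continuous w' ∧ (∀ σ, 0 ≤ w σ) ∧
      (∀ σ, w σ ≤ 1) ∧ (∀ σ, 0 ≤ w' σ) ∧ (∀ σ ≤ δ, w σ = 0) ∧ ∀ σ, 2 * δ ≤ σ → w σ = 1 := by
  set w : ℝ → ℝ := fun σ => Real.smoothTransition ((σ - δ) / δ) with hw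
  have hs : ContDiff ℝ ∞ w :=
    Real.smoothTransition.contDiff.comp ((contDiff_id.sub contDiff_const).div_const δ)
  have hd := contDiff_infty_iff_deriv.1 hs
  have hm : Monotone w := fun x y hxy =>
    Real.smoothTransition.monotone (div_le_div_of_nonneg_right (by linarith) hδ.le)
  refine ⟨w, deriv w, fun σ => (hd.1 σ).hasDerivAt, hd.2.continuous,
    fun σ => Real.smoothTransition.nonneg _, fun σ => Real.smoothTransition.le_one _,
    fun σ => hm.deriv_nonneg, fun σ hσ => ?_, fun σ hσ => ?_⟩
  · exact Real.smoothTransition.zero_of_nonpos (div_nonpos_of_nonpos_of_nonneg (by linarith) hδ.le)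
  · refine Real.smoothTransition.one_of_one_le ?_
    rw [le_div_iff₀ hδ]; linarith

lemma bump_isKernel (φ : ContDiffBump (0 : ℝ)) : IsKernel φ.rOut (φ.normed volume) :=
  ⟨φ.contDiff_normed, by rw [φ.tsupport_normed_eq, Real.closedBall_eq_Icc]; simp⟩

/-- A function in `H¹(c,d)` vanishing at `c` is bounded in `H¹` by its derivative. -/
lemma MemH1.h1Norm_le {c d : ℝ} (hcd : c ≤ d) {u : ℝ → ℝ} (hu : MemH1 c d u) (h0 : u c = 0) :
    h1Norm c d u ≤ √(((d - c) ^ 2 + 1) * ∫ x in c..d, deriv u x ^ 2) := by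
  have i1 : IntervalIntegrable (deriv u) volume c d := hu.1.intervalIntegrable_deriv
  have i2 : IntervalIntegrable (fun x => deriv u x ^ 2) volume c d := by
    rw [intervalIntegrable_iff_integrableOn_Ioo_of_le hcd]
    exact hu.2.integrable_sq
  set Q := ∫ x in c..d, deriv u x ^ 2 with hQ
  have hQ0 : 0 ≤ Q := intervalIntegral.integral_nonneg hcd fun _ _ => sq_nonneg _
  have pt : ∀ t ∈ Icc c d, u t ^ 2 ≤ (d - c) * Q := by
    intro t ht
    have hsub : uIcc c t ⊆ uIcc c d := by
      rw [uIcc_of_le hcd, uIcc_of_le ht.1]; exact Icc_subset_Icc_right ht.2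
    have e := (hu.1.mono hsub).integral_deriv_eq_sub
    rw [h0, sub_zero, intervalIntegral.integral_of_le ht.1] at e
    have j1 := (i1.mono_set hsub).1
    have j2 := (i2.mono_set hsub).1
    have := sq_integral_mul_le (μ := volume.restrict (Ioc c t)) (f := fun _ => 1) (u := deriv u)
      (fun _ => zero_le_one) (integrable_const _) (by simp only [one_mul]; exact j1)
      (by simp only [one_mul]; exact j2)
    simp only [one_mul, e] at this
    refine this.trans ?_
    have h3 : ∫ x in Ioc c t, deriv u x ^ 2 ≤ Q := by
      rw [hQ, intervalIntegral.integral_of_le hcd]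
      exact setIntegral_mono_set i2.1 (ae_of_all _ fun _ => sq_nonneg _)
        (Ioc_subset_Ioc_right ht.2).eventuallyLE
    have h4 : ∫ _ in Ioc c t, (1 : ℝ) = t - c := by simp [ht.1]
    rw [h4]
    exact mul_le_mul (by linarith [ht.2]) h3
      (integral_nonneg fun _ => sq_nonneg _) (by linarith)
  refine Real.sqrt_le_sqrt ?_
  have hc : ContinuousOn (fun t => u t ^ 2) (uIcc c d) := hu.1.continuousOn.pow 2
  have hm : ∫ t in c..d, u t ^ 2 ≤ ∫ _ in c..d, (d - c) * Q :=
    intervalIntegral.integral_mono_on hcd hc.intervalIntegrable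
      (continuous_const.intervalIntegrable _ _) pt
  rw [intervalIntegral.integral_const, smul_eq_mul] at hm
  linarith

/-! ### Traces of the time averages at `x = 0` and `x = L`. -/

section Boundary

variable {L T ε t : ℝ} {D : ℝ → H L} {f : ℝ → ℝ}

lemma IsKernel.inner_timeAvg (hf : IsKernel ε f) (ht : t ∈ Ioo ε (T - ε)) (hD : Continuous D)
    (c : H L) : ⟪c, timeAvg f D t⟫ = ∫ τ, f (t - τ) * ⟪c, D τ⟫ := by
  rw [timeAvg, ← integral_inner ((hf.isTest ht).integrable_smul hD)]
  simp only [inner_smul_right]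

/-- The translate `f(t - ·)` is a test function on `(0,T)`, so the distributional limit defining `g`
becomes a pointwise limit for the average, with value the mollification of `g` extended by zero. -/
lemma tendsto_inner_timeAvg_div (hL : 0 < L) (hT : 0 < T) (hf : IsKernel ε f)
    (ht : t ∈ Ioo ε (T - ε)) (hD : Continuous D) {ψ : ℝ → ℝ → ℝ} {g : ℝ → ℝ}
    (hψ : ∀ τ ∈ Ioo 0 T, ∀ x ∈ Icc 0 L, ⟪chi L x, D τ⟫ = ψ x τ)
    (hg : IsLateralDerivAtZero T ψ g) :
    Tendsto (fun h => ⟪chi L h, timeAvg f D t⟫ / h) (𝓝[>] 0)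
      (𝓝 (∫ τ, f (t - τ) * (Ioo 0 T).indicator g τ)) := by
  have hη := hf.isTest ht
  have key := hg _ hη.smooth hη.compact hη.tsupport_subset
  have full : ∀ u : ℝ → ℝ, ∫ τ in (0 : ℝ)..T, u τ = ∫ τ, (Ioo 0 T).indicator u τ := fun u => by
    rw [integral_indicator measurableSet_Ioo, integral_Ioo_eq hT.le]
  have e : ∫ τ, (Ioo 0 T).indicator (fun τ => g τ * f (t - τ)) τ =
      ∫ τ, f (t - τ) * (Ioo 0 T).indicator g τ := by
    refine integral_congr_ae (ae_of_all _ fun τ => ?_)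
    by_cases hτ : τ ∈ Ioo 0 T
    · simp only [indicator_of_mem hτ, mul_comm]
    · simp only [indicator_of_notMem hτ, mul_zero]
  rw [full, e] at key
  refine key.congr' ?_
  filter_upwards [Ioo_mem_nhdsGT hL] with x hx
  rw [full, hf.inner_timeAvg ht hD, ← integral_div]
  refine integral_congr_ae (ae_of_all _ fun τ => ?_)
  by_cases hτ : τ ∈ Ioo 0 T
  · simp only [indicator_of_mem hτ]
    rw [hψ τ hτ x (Ioo_subset_Icc_self hx), ← hψ τ hτ 0 ⟨le_rfl, hL.le⟩, chi_zero,
      inner_zero_left]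
    ring
  · simp only [indicator_of_notMem hτ]
    rw [hη.eq_zero hτ]; simp

/-- For such `t` the kernel lives inside `(c,T)`, where the boundary datum is `s₀`. It vanishes at
both endpoints, so integration by parts leaves no boundary terms and the value `s₀ c` plays no role.
-/
lemma inner_chi_timeAvg_deriv (hL : 0 < L) {c : ℝ} (hc : 0 ≤ c) (hε : 0 < ε) (hf : IsKernel ε f)
    (ht : t ∈ Ioo (c + ε) (T - ε)) (hD : Continuous D) {ψ : ℝ → ℝ → ℝ} {s₀ : ℝ → ℝ}
    (hψ : ∀ τ ∈ Ioo 0 T, ∀ x ∈ Icc 0 L, ⟪chi L x, D τ⟫ = ψ x τ)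
    (hs : ∀ τ ∈ Ioo 0 T, ψ L τ = (Ici c).indicator s₀ τ) (hs₀ : MemH1 c T s₀) :
    ⟪chi L L, timeAvg (deriv f) D t⟫ = ∫ τ, f (t - τ) * (Ioo c T).indicator (deriv s₀) τ := by
  have hcT : c ≤ T := by linarith [ht.1, ht.2]
  have ht' : t ∈ Ioo ε (T - ε) := ⟨by linarith [ht.1], ht.2⟩
  have hz : ∀ {k : ℝ → ℝ}, IsKernel ε k → ∀ τ, τ ∉ Ioo c T → k (t - τ) = 0 := by
    intro k hk τ hτ
    refine hk.eq_zero fun h => hτ ⟨by linarith [h.2, ht.1], by linarith [h.1, ht.2]⟩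
  have full : ∀ u : ℝ → ℝ, ∫ τ in c..T, u τ = ∫ τ, (Ioo c T).indicator u τ := fun u => by
    rw [integral_indicator measurableSet_Ioo, intervalIntegral.integral_of_le hcT,
      integral_Ioc_eq_integral_Ioo]
  have e1 : ⟪chi L L, timeAvg (deriv f) D t⟫ = ∫ τ in c..T, deriv f (t - τ) * s₀ τ := by
    rw [hf.deriv.inner_timeAvg ht' hD, full]
    refine integral_congr_ae (ae_of_all _ fun τ => ?_)
    by_cases hτ : τ ∈ Ioo c T
    · have hτ' : τ ∈ Ioo 0 T := ⟨hc.trans_lt hτ.1, hτ.2⟩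
      simp only [indicator_of_mem hτ]
      rw [hψ τ hτ' L ⟨hL.le, le_rfl⟩, hs τ hτ', indicator_of_mem (mem_Ici.2 hτ.1.le)]
    · simp only [indicator_of_notMem hτ]
      rw [hz hf.deriv τ hτ, zero_mul]
  have e2 : ∫ τ, f (t - τ) * (Ioo c T).indicator (deriv s₀) τ
      = ∫ τ in c..T, f (t - τ) * deriv s₀ τ := by
    rw [full]
    refine integral_congr_ae (ae_of_all _ fun τ => ?_)
    by_cases hτ : τ ∈ Ioo c T
    · simp only [indicator_of_mem hτ]
    · simp only [indicator_of_notMem hτ, mul_zero]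
  have hη := hf.isTest ht'
  have ac : AbsolutelyContinuousOnInterval (fun τ => f (t - τ)) c T :=
    ContDiffOn.absolutelyContinuousOnInterval (hη.smooth.of_le (by simp)).contDiffOn
  have ibp := ac.integral_deriv_mul_eq_sub hs₀.1
  rw [hz hf T (by simp), hz hf c (by simp), zero_mul, zero_mul, sub_zero,
    deriv_comp_const_sub'] at ibp
  have i1 : IntervalIntegrable (fun τ => deriv f (t - τ) * s₀ τ) volume c T :=
    (((hf.deriv.smooth.continuous.comp (continuous_const.sub continuous_id)).continuousOn).mul
      hs₀.1.continuousOn).intervalIntegrable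
  have i2 : IntervalIntegrable (fun τ => f (t - τ) * deriv s₀ τ) volume c T :=
    hs₀.1.intervalIntegrable_deriv.continuousOn_mul hη.smooth.continuous.continuousOn
  have : ∫ τ in c..T, (-deriv f (t - τ) * s₀ τ + f (t - τ) * deriv s₀ τ) =
      (∫ τ in c..T, f (t - τ) * deriv s₀ τ) - ∫ τ in c..T, deriv f (t - τ) * s₀ τ := by
    rw [← intervalIntegral.integral_sub i2 i1]
    exact intervalIntegral.integral_congr fun τ _ => by ring
  rw [e1, e2]
  linarith

end Boundary

/-! ### The slowness, the limit of concentrating kernels and the conclusion. -/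

lemma slowness_spec {L ρ₀ ρ₁ a₀ a₁ : ℝ} {ρ a ρ' a' : ℝ → ℝ} (hL : 0 < L)
    (hρ₀ : 0 < ρ₀) (ha₀ : 0 < a₀)
    (hρ : ρ =ᵐ[volume.restrict (Ioo 0 L)] ρ') (ha : a =ᵐ[volume.restrict (Ioo 0 L)] a')
    (hρb : ∀ x, ρ₀ ≤ ρ' x ∧ ρ' x ≤ ρ₁) (hab : ∀ x, a₀ ≤ a' x ∧ a' x ≤ a₁) :
    0 ≤ slowness L ρ a ∧
      ∀ᵐ x ∂(volume.restrict (Ioo 0 L)), ρ' x * (a' x)⁻¹ ≤ slowness L ρ a ^ 2 := by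
  have hb : ∀ᵐ x ∂(volume.restrict (Icc 0 L)), √(ρ x / a x) ≤ √(ρ₁ / a₀) := by
    rw [← restrict_Ioo_eq_restrict_Icc]
    filter_upwards [hρ, ha] with x h1 h2
    rw [h1, h2]
    exact Real.sqrt_le_sqrt (div_le_div₀ (hρ₀.le.trans ((hρb x).1.trans (hρb x).2)) (hρb x).2 ha₀
      (hab x).1)
  -- A real-valued `essSup` is an essential upper bound only once essential boundedness is known,
  -- which `hb` supplies.
  have hle : ∀ᵐ x ∂(volume.restrict (Icc 0 L)), √(ρ x / a x) ≤ slowness L ρ a :=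
    ae_le_essSup ⟨_, eventually_map.2 hb⟩
  rw [← restrict_Ioo_eq_restrict_Icc] at hle
  have h0 : 0 ≤ slowness L ρ a := by
    have : (volume.restrict (Ioo 0 L)) ≠ 0 := by simp [Measure.restrict_eq_zero, hL]
    have : (ae (volume.restrict (Ioo 0 L))).NeBot := ae_neBot.2 this
    obtain ⟨x, hx⟩ := hle.exists
    exact (Real.sqrt_nonneg _).trans hx
  refine ⟨h0, ?_⟩
  filter_upwards [hle, hρ, ha] with x h1 h2 h3
  rw [← h2, ← h3, ← div_eq_mul_inv]
  exact (Real.sqrt_le_left h0).1 h1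

/-- The bound of the lateral trace at `x = L` by the lateral derivative at `x = 0`, given the
weights `r` and `q`. -/
lemma IsFiniteEnergySolution.integral_deriv_sq_le {L T ρ₀ ρ₁ a₀ a₁ β : ℝ}
    {ρ a ρ' a' r q θ s₀ g : ℝ → ℝ} {ψ ψt : ℝ → ℝ → ℝ} (hL : 0 < L) (hρ₀ : 0 < ρ₀) (ha₀ : 0 < a₀)
    (hβ : 0 ≤ β) (hT : L * β < T)
    (hρ : ρ =ᵐ[volume.restrict (Ioo 0 L)] ρ') (ha : a =ᵐ[volume.restrict (Ioo 0 L)] a')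
    (hρm : Measurable ρ') (ham : Measurable a')
    (hρb : ∀ x, ρ₀ ≤ ρ' x ∧ ρ' x ≤ ρ₁) (hab : ∀ x, a₀ ≤ a' x ∧ a' x ≤ a₁)
    (hβ2 : ∀ᵐ x ∂(volume.restrict (Ioo 0 L)), ρ' x * (a' x)⁻¹ ≤ β ^ 2)
    (hr : Antitone r) (hq : Antitone q) (hrL : 0 < r L) (hqL : 0 < q L)
    (hθ : ∀ x ∈ Ioo 0 L, 0 ≤ θ x ∧ θ x ≤ 1 ∧ r x = θ x * ρ' x ∧ q x = θ x * (a' x)⁻¹)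
    (hs₀ : MemH1 (L * β) T s₀)
    (h : IsFiniteEnergySolution L T ρ a ((Ici (L * β)).indicator s₀) ψ ψt g) :
    r L * ∫ t in L * β..T, deriv s₀ t ^ 2 ≤ q 0 * a₁ ^ 2 * ∫ t in (0 : ℝ)..T, g t ^ 2 := by
  set c := L * β with hc
  have hc0 : 0 ≤ c := mul_nonneg hL.le hβ
  have hT0 : 0 < T := hc0.trans_lt hT
  have hρp : ∀ x, 0 < ρ' x := fun x => hρ₀.trans_le (hρb x).1
  have hap : ∀ x, 0 < a' x := fun x => ha₀.trans_le (hab x).1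
  have hρ₁ : 0 < ρ₁ := (hρp 0).trans_le (hρb 0).2
  have ha₁ : 0 < a₁ := (hap 0).trans_le (hab 0).2
  have hq0 : 0 < q 0 := hqL.trans_le (hq hL.le)
  have hinv : ∀ x, 0 < (a' x)⁻¹ ∧ (a' x)⁻¹ ≤ a₀⁻¹ := fun x =>
    ⟨inv_pos.2 (hap x), inv_anti₀ ha₀ (hab x).1⟩
  have ha₀' : 0 < a₀⁻¹ := inv_pos.2 ha₀
  have hpos : 0 < ρ₁ * a₀⁻¹ := mul_pos hρ₁ ha₀'
  -- A single bound for `ρ'`, `a'`, `1/a'` and, as `θ ≤ 1`, for `θρ'/a'`.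
  set K := ρ₁ + a₁ + a₀⁻¹ + ρ₁ * a₀⁻¹ with hK
  have hK0 : 0 < K := by positivity
  have hρK : ∀ x, |ρ' x| ≤ K := fun x => by
    rw [abs_of_pos (hρp x)]; linarith [(hρb x).2]
  have haK : ∀ x, |a' x| ≤ K := fun x => by
    rw [abs_of_pos (hap x)]; linarith [(hab x).2]
  have hαK : ∀ x, |(a' x)⁻¹| ≤ K := fun x => by
    rw [abs_of_pos (hinv x).1]; linarith [(hinv x).2]
  have hcoef : ∀ᵐ x, x ∈ Ioc 0 L → 0 ≤ θ x ∧ 0 ≤ ρ' x ∧ 0 ≤ (a' x)⁻¹ ∧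
      ρ' x * (a' x)⁻¹ ≤ β ^ 2 ∧ r x = θ x * ρ' x ∧ q x = θ x * (a' x)⁻¹ ∧
      θ x * ρ' x * (a' x)⁻¹ ≤ K := by
    rw [← ae_restrict_iff' measurableSet_Ioc, ← restrict_Ioo_eq_restrict_Ioc]
    filter_upwards [hβ2, ae_restrict_mem measurableSet_Ioo] with x h1 hx
    obtain ⟨t0, t1, t2, t3⟩ := hθ x hx
    refine ⟨t0, (hρp x).le, (hinv x).1.le, h1, t2, t3, ?_⟩
    have : θ x * ρ' x ≤ ρ₁ := (mul_le_of_le_one_left (hρp x).le t1).trans (hρb x).2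
    have := mul_le_mul this (hinv x).2 (hinv x).1.le hρ₁.le
    linarith
  obtain ⟨D, W, hw, hψ, DT, WT⟩ := h.exists_isWeakWave hL hT0 hρ ha hρm ham hρK haK
  obtain ⟨A, hA, hAn⟩ := exists_mulCLM (L := L) ham (K := a₁)
    (fun x => by rw [abs_of_pos (hap x)]; exact (hab x).2)
  obtain ⟨R, hR, -⟩ := exists_mulCLM (L := L) hρm hρK
  set u : ℝ → ℝ := (Ioo 0 T).indicator g with hu
  have gi : IntegrableOn g (Ioo 0 T) := h.lateral_memL2.integrable one_le_two
  have ui : Integrable u := gi.integrable_indicator measurableSet_Ioo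
  have u2 : (fun t => u t ^ 2) = (Ioo 0 T).indicator fun t => g t ^ 2 := by
    ext t
    by_cases ht : t ∈ Ioo 0 T
    · simp only [hu, indicator_of_mem ht]
    · simp only [hu, indicator_of_notMem ht]; ring
  have u2i : Integrable fun t => u t ^ 2 := by
    rw [u2]
    exact IntegrableOn.integrable_indicator (MemLp.integrable_sq h.lateral_memL2) measurableSet_Ioo
  have u2e : ∫ t, u t ^ 2 = ∫ t in (0 : ℝ)..T, g t ^ 2 := by
    rw [u2, integral_indicator measurableSet_Ioo, integral_Ioo_eq hT0.le]
  set v : ℝ → ℝ := (Ioo c T).indicator (deriv s₀) with hv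
  have s₀i : IntegrableOn (deriv s₀) (Ioo c T) := hs₀.2.integrable one_le_two
  have vi : Integrable v := s₀i.integrable_indicator measurableSet_Ioo
  -- One scale `δ` governs everything: the kernel has radius `δ/2`, the estimate runs over `[δ, T -
  -- δ]`, and `w` rises from `0` to `1` on `[δ, 2δ]`. At `x = L` the weight is thus `1` for `t ≥ c +
  -- 2δ`. The averages at `T - δ` only see times in `[T - 2δ, T]`.
  have step : ∀ (φ : ContDiffBump (0 : ℝ)) (δ S : ℝ), φ.rOut = δ / 2 → 3 * δ < T - c →
      (∀ τ ∈ Icc (T - 2 * δ) T, ‖D τ‖ ≤ S ∧ ‖W τ‖ ≤ S) →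
      r L * (∫ t, (Ioo (c + 2 * δ) (T - δ)).indicator
        (fun t => (∫ τ, φ.normed volume (t - τ) * v τ) ^ 2) t) ≤
      q 0 * a₁ ^ 2 * (∫ t in (0 : ℝ)..T, g t ^ 2) + K * (1 + a₁ ^ 2) * S ^ 2 := by
    intro φ δ S hφ hδ hS
    have hδ0 : 0 < δ := by linarith [φ.rOut_pos]
    set f := φ.normed volume with hf
    have fk : IsKernel (δ / 2) f := hφ ▸ bump_isKernel φ
    have f0 : ∀ σ, 0 ≤ f σ := fun σ => φ.nonneg_normed σ
    have f1 : ∫ σ, f σ = 1 := φ.integral_normed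
    obtain ⟨w, w', hwd, hwc, hw0, hw1, hw'0, hwt, hwone⟩ := exists_cutoff hδ0
    have hwcont : Continuous w := continuous_iff_continuousAt.2 fun σ => (hwd σ).continuousAt
    have ht01 : δ ≤ T - δ := by linarith
    have E := hw.timeAvg_energy_le (t₀ := δ) (t₁ := T - δ) (S := S) hL hA hAn hR hap
      (fun x => (hab x).2) hβ hr hq hqL.le
      hρm ham hρK hαK hcoef hwd hwc hw0 hw1 hw'0 hwt fk f0 f1 (by linarith) ht01 (by linarith)
      (fun τ hτ => hS τ ⟨by linarith [hτ.1], by linarith [hτ.2]⟩)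
      (((fk.continuous_integral_mul ui).pow 2).intervalIntegrable _ _)
      (fun t ht => tendsto_inner_timeAvg_div hL hT0 fk ⟨by linarith [ht.1], by linarith [ht.2]⟩
        hw.contD hψ h.lateral)
    have e1 := fk.integral_sq_le f0 f1 ui u2i ht01
    rw [u2e] at e1
    have e2 : ∫ t, (Ioo (c + 2 * δ) (T - δ)).indicator (fun t => (∫ τ, f (t - τ) * v τ) ^ 2) t ≤
        ∫ t in δ..(T - δ), w (t - β * L) * ⟪chi L L, timeAvg (deriv f) D t⟫ ^ 2 := by
      have cV : Continuous fun t => w (t - β * L) * ⟪chi L L, timeAvg (deriv f) D t⟫ ^ 2 := by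
        have := continuous_timeAvg fk.deriv.smooth fk.deriv.compact hw.contD
        have : Continuous fun t => ⟪chi L L, timeAvg (deriv f) D t⟫ := continuous_const.inner this
        fun_prop
      have ce : ∀ t ∈ Ioo (c + 2 * δ) (T - δ), (∫ τ, f (t - τ) * v τ) ^ 2 =
          w (t - β * L) * ⟪chi L L, timeAvg (deriv f) D t⟫ ^ 2 := by
        intro t ht
        rw [hwone _ (by rw [mul_comm β L, ← hc]; linarith [ht.1]), one_mul,
          inner_chi_timeAvg_deriv hL hc0 (by linarith) fk ⟨by linarith [ht.1], by linarith [ht.2]⟩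
            hw.contD hψ h.right hs₀]
      rw [integral_indicator measurableSet_Ioo, setIntegral_congr_fun measurableSet_Ioo ce,
        intervalIntegral.integral_of_le ht01]
      refine setIntegral_mono_set (cV.intervalIntegrable _ _).1
        (ae_of_all _ fun t => mul_nonneg (hw0 _) (sq_nonneg _)) ?_
      refine LE.le.eventuallyLE fun t ht => ⟨by linarith [ht.1], ht.2.le⟩
    have e3 := mul_le_mul_of_nonneg_left e2 hrL.le
    have e4 := mul_le_mul_of_nonneg_left e1 (by positivity : 0 ≤ q 0 * a₁ ^ 2)
    linarith
  set ℓ := T - c with hℓ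
  have hℓ0 : 0 < ℓ := by linarith
  -- The shift by `4` ensures `3 δ n < ℓ` already for `n = 0`.
  set δ : ℕ → ℝ := fun n => ℓ / (n + 4) with hδ
  have hδ0 : ∀ n, 0 < δ n := fun n => by positivity
  have hδ3 : ∀ n, 3 * δ n < ℓ := fun n => by
    simp only [hδ]
    rw [← mul_div_assoc, div_lt_iff₀ (by positivity)]
    have : (0 : ℝ) ≤ n := n.cast_nonneg
    nlinarith
  have hδl : Tendsto δ atTop (𝓝 0) := by
    have := (tendsto_const_div_atTop_nhds_zero_nat ℓ).comp (tendsto_add_atTop_nat 4)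
    refine this.congr fun n => ?_
    simp [hδ]
  set φ : ℕ → ContDiffBump (0 : ℝ) := fun n =>
    ⟨δ n / 4, δ n / 2, by linarith [hδ0 n], by linarith [hδ0 n]⟩ with hφ
  have conv : ∀ᵐ t, Tendsto (fun n => ∫ τ, (φ n).normed volume (t - τ) * v τ) atTop (𝓝 (v t)) := by
    -- Lebesgue differentiation for bumps with bounded ratio `rOut / rIn`, here equal to `2`.
    have := ContDiffBump.ae_convolution_tendsto_right_of_locallyIntegrable (μ := volume)
      (φ := φ) (l := atTop) (K := 2) (g := v) ?_ ?_ vi.locallyIntegrable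
    · filter_upwards [this] with t ht
      refine ht.congr fun n => IsKernel.convolution_eq v t
    · have := hδl.div_const 2
      simpa [hφ] using this
    · refine Eventually.of_forall fun n => ?_
      simp only [hφ]; linarith
  have lim : ∀ᵐ t, Tendsto (fun n => (Ioo (c + 2 * δ n) (T - δ n)).indicator
      (fun t => (∫ τ, (φ n).normed volume (t - τ) * v τ) ^ 2) t) atTop (𝓝 (v t ^ 2)) := by
    filter_upwards [conv] with t ht
    by_cases htm : t ∈ Ioo c T
    · refine (ht.pow 2).congr' ?_
      have l1 : Tendsto (fun n => c + 2 * δ n) atTop (𝓝 c) := by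
        simpa using (hδl.const_mul 2).const_add c
      have l2 : Tendsto (fun n => T - δ n) atTop (𝓝 T) := by
        simpa using hδl.const_sub T
      filter_upwards [l1.eventually (gt_mem_nhds htm.1), l2.eventually (lt_mem_nhds htm.2)]
        with n h1 h2
      rw [indicator_of_mem (show t ∈ Ioo _ _ from ⟨h1, h2⟩)]
    · have : v t = 0 := indicator_of_notMem htm _
      rw [this]
      refine tendsto_const_nhds.congr fun n => ?_
      rw [indicator_of_notMem]
      · simp
      · exact fun h' => htm ⟨by linarith [h'.1, hδ0 n], by linarith [h'.2, hδ0 n]⟩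
  -- For fixed `e`, Fatou's lemma in `n`. By continuity and `D T = W T = 0`, both curves have norm
  -- below `e` on `[T - 2 δ n, T]` for large `n`, so `S = e` is allowed in `step`. Only afterwards
  -- does `e` tend to `0`.
  have small : ∀ e : ℝ, 0 < e → ∫ t, v t ^ 2 ≤
      (q 0 * a₁ ^ 2 * (∫ t in (0 : ℝ)..T, g t ^ 2) + K * (1 + a₁ ^ 2) * e ^ 2) / r L := by
    intro e he
    refine integral_le_of_tendsto_ae (fun n => ?_) (fun n t => ?_)
      (vi.aestronglyMeasurable.pow 2) lim ?_
    · have fk := bump_isKernel (φ n)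
      exact IntegrableOn.integrable_indicator
        ((((fk.continuous_integral_mul vi).pow 2).intervalIntegrable
          (c + 2 * δ n) (T - δ n)).1.mono_set Ioo_subset_Ioc_self) measurableSet_Ioo
    · exact indicator_nonneg (fun _ _ => sq_nonneg _) t
    · have nD : ∀ᶠ τ in 𝓝 T, ‖D τ‖ < e ∧ ‖W τ‖ < e := by
        refine (hw.contD.norm.continuousAt.eventually (gt_mem_nhds ?_)).and
          (hw.contW.norm.continuousAt.eventually (gt_mem_nhds ?_))
        · simpa only [DT, norm_zero] using he
        · simpa only [WT, norm_zero] using he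
      obtain ⟨d, hd, hdD⟩ := Metric.eventually_nhds_iff.1 nD
      have : ∀ᶠ n in atTop, 2 * δ n < d := by
        have := hδl.const_mul 2
        rw [mul_zero] at this
        exact this.eventually (gt_mem_nhds hd)
      filter_upwards [this] with n hn
      rw [le_div_iff₀ hrL, mul_comm]
      refine step (φ n) (δ n) e rfl (hδ3 n) fun τ hτ => ?_
      have := hdD (y := τ) (by
        rw [Real.dist_eq, abs_lt]; constructor <;> linarith [hτ.1, hτ.2, hδ0 n])
      exact ⟨this.1.le, this.2.le⟩
  have v2 : ∫ t, v t ^ 2 = ∫ t in c..T, deriv s₀ t ^ 2 := by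
    have : (fun t => v t ^ 2) = (Ioo c T).indicator fun t => deriv s₀ t ^ 2 := by
      ext t
      by_cases ht : t ∈ Ioo c T
      · simp only [hv, indicator_of_mem ht]
      · simp only [hv, indicator_of_notMem ht]; ring
    rw [this, integral_indicator measurableSet_Ioo, intervalIntegral.integral_of_le hT.le,
      integral_Ioc_eq_integral_Ioo]
  rw [← v2]
  have lim0 : Tendsto (fun e : ℝ =>
      (q 0 * a₁ ^ 2 * (∫ t in (0 : ℝ)..T, g t ^ 2) + K * (1 + a₁ ^ 2) * e ^ 2)) (𝓝[>] 0)
      (𝓝 (q 0 * a₁ ^ 2 * (∫ t in (0 : ℝ)..T, g t ^ 2) + K * (1 + a₁ ^ 2) * 0 ^ 2)) :=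
    tendsto_nhdsWithin_of_tendsto_nhds (Continuous.tendsto (by fun_prop) _)
  have fin := ge_of_tendsto lim0 (b := r L * ∫ t, v t ^ 2) (by
    filter_upwards [self_mem_nhdsWithin] with e he
    have := small e he
    rwa [le_div_iff₀ hrL, mul_comm] at this)
  simpa using fin

end SidewiseWave

end

theorem proposition2p1 (L T ρ₀ ρ₁ a₀ a₁ : ℝ) (ρ a : ℝ → ℝ)
    (hL : 0 < L) (hρ₀ : 0 < ρ₀) (ha₀ : 0 < a₀)
    (hρ : ∀ᵐ x ∂(volume.restrict (Ioo 0 L)), ρ₀ ≤ ρ x ∧ ρ x ≤ ρ₁)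
    (ha : ∀ᵐ x ∂(volume.restrict (Ioo 0 L)), a₀ ≤ a x ∧ a x ≤ a₁)
    (hρBV : SidewiseWave.MemBV 0 L ρ) (haBV : SidewiseWave.MemBV 0 L a)
    (hT : L * SidewiseWave.slowness L ρ a < T) :
    ∃ C₁ : ℝ, 0 < C₁ ∧
      ∀ s₀ : ℝ → ℝ,
        SidewiseWave.MemH1 (L * SidewiseWave.slowness L ρ a) T s₀ →
        s₀ (L * SidewiseWave.slowness L ρ a) = 0 →
        ∀ (ψ ψt : ℝ → ℝ → ℝ) (g : ℝ → ℝ),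
          SidewiseWave.IsFiniteEnergySolution L T ρ a
            ((Ici (L * SidewiseWave.slowness L ρ a)).indicator s₀) ψ ψt g →
          SidewiseWave.h1Norm (L * SidewiseWave.slowness L ρ a) T s₀
            ≤ C₁ * SidewiseWave.l2Norm 0 T g := by
  open SidewiseWave in
  obtain ⟨ρ', mρ, Nρ, ρm, ρb, ρe, mρm, mρb, mρi⟩ := hρBV.exists_representative hL hρ
  obtain ⟨a', ma, Na, am, ab, ae, mam, mab, mai⟩ := haBV.exists_representative hL ha
  obtain ⟨r, q, θ, hr, hq, hrL, hqL, hθ⟩ :=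
    exists_weights hρ₀ ha₀ ρb ab mρm mρb mρi mam mab mai
  obtain ⟨hβ, hβ2⟩ := slowness_spec hL hρ₀ ha₀ ρe ae ρb ab
  set β := slowness L ρ a
  have ha₁ : 0 < a₁ := ha₀.trans_le ((ab 0).1.trans (ab 0).2)
  have hq0 : 0 < q 0 := hqL.trans_le (hq hL.le)
  -- The Poincaré constant of `MemH1.h1Norm_le` times the constant of the sidewise estimate. The
  -- weights depend only on the coefficients, hence so does the second factor.
  set C := ((T - L * β) ^ 2 + 1) * (q 0 * a₁ ^ 2 / r L) with hC
  have hC0 : 0 < C := by positivity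
  refine ⟨√C, Real.sqrt_pos.2 hC0, fun s₀ hs₀ h0 ψ ψt g h => ?_⟩
  refine (hs₀.h1Norm_le hT.le h0).trans ?_
  have key := h.integral_deriv_sq_le hL hρ₀ ha₀ hβ hT ρe ae ρm am ρb ab hβ2 hr hq hrL hqL hθ hs₀
  rw [l2Norm, ← Real.sqrt_mul hC0.le]
  refine Real.sqrt_le_sqrt ?_
  rw [hC, mul_assoc]
  refine mul_le_mul_of_nonneg_left ?_ (by positivity)
  rw [div_mul_eq_mul_div, le_div_iff₀ hrL, mul_comm]
  exact key
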